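/- Let $n,m\ge 1$, let $A\in\mathbb{R}^{m\times m}$ and $C\in\mathbb{R}^{n\times n}$ be symmetric, $B\in\mathbb{R}^{n\times m}$, $z^*=(x^*,y^*)\in\mathbb{R}^n\times\mathbb{R}^m$, and $$f(x;y)=-\tfrac12(y-y^*)^\top A(y-y^*)+(x-x^*)^\top B(y-y^*)+\tfrac12(x-x^*)^\top C(x-x^*).$$ Assume $\mu I\le A\le LI$, $\|B\|_2,\|C\|_2\le L$ and $C+BA^{-1}B^\top\ge\mu_xI$, where $\mu>0$ and $0<\mu_x\le L$. Put $\kappa=L/\mu$ and $\kappa_x=L/\mu_x$, let $r\ge 2\kappa$, and use the stepsizes $\eta_x=\frac1{4rL}$, $\eta_y=\frac1{4L}$. Let $M=\begin{pmatrix}-C&-B\\ rB^\top&-rA\end{pmatrix}=P^{-1}JP$ be a Jordan decomposition over $\mathbb{C}$, normalized so that the nonzero superdiagonal entries of $J$ are equal to some $\delta\in(0,\mu_x/64]$. (Every $M$ has such a decomposition for every such $\delta$; if $M$ is diagonalizable, $M=P^{-1}JP$ may be any eigenvalue decomposition and $\delta$ plays no role.) Let $C_P=\|P\|_2\|P^{-1}\|_2$.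 The $j$-th call of a stochastic gradient oracle with mini-batch size $S\ge1$, at a query point $z$, returns $(g_x(z),g_y(z))$ at the cost of $S$ gradient evaluations. For the noises $\xi_x=g_x(z)-\nabla_xf(z)$ and $\xi_y=g_y(z)-\nabla_yf(z)$ of the calls that the algorithm makes, assume $\mathbb{E}\,\xi_x=0$, $\mathbb{E}\,\xi_y=0$, $\mathbb{E}\|\xi_x\|_2^2\le\sigma^2/S$, $\mathbb{E}\|\xi_y\|_2^2\le\sigma^2/S$ ($\sigma\ge0$), and that the noises $(\xi_x,\xi_y)$ of different calls are independent. From a deterministic $z^0$, SGDA iterates $x^{k+1}=x^k-\eta_xg_x(z^k)$, $y^{k+1}=y^k+\eta_yg_y(z^k)$. Stochastic EG first computes $x^{k+1/2}=x^k-\eta_xg_x(z^k)$, $y^{k+1/2}=y^k+\eta_yg_y(z^k)$, and then $x^{k+1}=x^k-\eta_xg_x(z^{k+1/2})$, $y^{k+1}=y^k+\eta_yg_y(z^{k+1/2})$, with a new oracle call at $z^{k+1/2}$. Then there are numerical constants $0<c_1\le1$ and $c_2,c_3>0$ such that the following hold in every such setting, both for SGDA and for stochastic EG. 1. For all $T\ge0$,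 $$\mathbb{E}\|z^T-z^*\|_2^2\le C_P^2\Big(1-\frac{c_1}{r\kappa_x}\Big)^{2T}\|z^0-z^*\|_2^2+\frac{c_2\,r\kappa_xC_P^2\sigma^2}{L^2S}.$$ 2. For every $\epsilon>0$ there are a number of steps $T$ and a batch size $S$, chosen independently of the oracle, such that $\mathbb{E}\|z^T-z^*\|_2\le\epsilon$ for every oracle of batch size $S$ that satisfies the noise assumption, while the total number of gradient evaluations ($TS$ for SGDA, $2TS$ for EG) is at most $$c_3\,r\kappa_x\max\Big\{1,\log\frac{C_P\|z^0-z^*\|_2}{\epsilon}\Big\}\max\Big\{1,\frac{r\kappa_xC_P^2\sigma^2}{L^2\epsilon^2}\Big\}$$ (with $\log 0$ read as $-\infty$ if $z^0=z^*$). -/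

import Mathlib

open MeasureTheory ProbabilityTheory
open scoped Matrix Matrix.Norms.L2Operator

universe u

noncomputable section

namespace QuadMinimax

/-- The Euclidean space in which the min player (or the max player) moves. -/
abbrev Eucl (n : ℕ) : Type := EuclideanSpace ℝ (Fin n)

variable {n m : ℕ}

/-- The quadratic objective
`f(x; y) = -1/2 (y - y*)ᵀ A (y - y*) + (x - x*)ᵀ B (y - y*) + 1/2 (x - x*)ᵀ C (x - x*)`. -/
def quadFun (A : Matrix (Fin m) (Fin m) ℝ) (B : Matrix (Fin n) (Fin m) ℝ)
    (C : Matrix (Fin n) (Fin n) ℝ) (zs : Eucl n × Eucl m) (x : Eucl n) (y : Eucl m) : ℝ :=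
  -(1 / 2) * ((y - zs.2).ofLp ⬝ᵥ (A *ᵥ (y - zs.2).ofLp))
    + (x - zs.1).ofLp ⬝ᵥ (B *ᵥ (y - zs.2).ofLp)
    + (1 / 2) * ((x - zs.1).ofLp ⬝ᵥ (C *ᵥ (x - zs.1).ofLp))

/-- The assumptions on a quadratic nonconvex-strongly-concave function: `A`, `C` are symmetric,
`μ I ≤ A ≤ L I`, `‖B‖₂ ≤ L`, `‖C‖₂ ≤ L` (spectral norms), and the Schur complement satisfies
`C + B A⁻¹ Bᵀ ≥ μ_x I` with `0 < μ_x ≤ L`. -/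
structure IsQuadNCSC (A : Matrix (Fin m) (Fin m) ℝ) (B : Matrix (Fin n) (Fin m) ℝ)
    (C : Matrix (Fin n) (Fin n) ℝ) (L μ μx : ℝ) : Prop where
  symm_A : A.IsSymm
  symm_C : C.IsSymm
  mu_pos : 0 < μ
  mu_le_A : (A - μ • (1 : Matrix (Fin m) (Fin m) ℝ)).PosSemidef
  A_le_L : (L • (1 : Matrix (Fin m) (Fin m) ℝ) - A).PosSemidef
  norm_B_le : ‖B‖ ≤ L
  norm_C_le : ‖C‖ ≤ L
  mux_pos : 0 < μx
  mux_le_L : μx ≤ L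
  mux_le_schur : (C + B * A⁻¹ * Bᵀ - μx • (1 : Matrix (Fin n) (Fin n) ℝ)).PosSemidef

/-- The matrix `M = [[-C, -B], [r Bᵀ, -r A]]` governing the dynamics. -/
def matM (A : Matrix (Fin m) (Fin m) ℝ) (B : Matrix (Fin n) (Fin m) ℝ)
    (C : Matrix (Fin n) (Fin n) ℝ) (r : ℝ) : Matrix (Fin n ⊕ Fin m) (Fin n ⊕ Fin m) ℝ :=
  Matrix.fromBlocks (-C) (-B) (r • Bᵀ) (-(r • A))

/-- `J` is in Jordan normal form, up to the choice of `δ` in place of `1` as the value of the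
nonzero entries above the diagonal: `J` vanishes off the diagonal and the first superdiagonal, and
each superdiagonal entry is either `0` (a block boundary) or `δ` (between two equal diagonal
entries). A diagonal matrix has this form for every `δ`. -/
structure IsJordanForm {N : ℕ} (J : Matrix (Fin N) (Fin N) ℂ) (δ : ℝ) : Prop where
  off_eq_zero : ∀ i j : Fin N, (j : ℕ) ≠ i → (j : ℕ) ≠ i + 1 → J i j = 0
  super : ∀ i j : Fin N, (j : ℕ) = i + 1 → J i j = 0 ∨ (J i j = (δ : ℂ) ∧ J i i = J j j)

/-- `M = P⁻¹ J P` is a Jordan decomposition over `ℂ`, with `δ` above the diagonal in the blocks.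
The `n + m` coordinates are numbered in the usual order, those of `x` first. -/
def IsJordanDecomp (M : Matrix (Fin n ⊕ Fin m) (Fin n ⊕ Fin m) ℝ)
    (P J : Matrix (Fin (n + m)) (Fin (n + m)) ℂ) (δ : ℝ) : Prop :=
  IsUnit P.det ∧ IsJordanForm J δ ∧
    (Matrix.reindex finSumFinEquiv finSumFinEquiv M).map (fun t : ℝ => (t : ℂ)) = P⁻¹ * J * P

/-- The condition number `C_P = ‖P‖₂ ‖P⁻¹‖₂` (spectral norms). -/
def condNum {N : ℕ} (P : Matrix (Fin N) (Fin N) ℂ) : ℝ :=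
  ‖P‖ * ‖P⁻¹‖

/-- The `ℓ₂` distance of two points of `ℝⁿ × ℝᵐ = ℝⁿ⁺ᵐ`. -/
def dist2 (z w : Eucl n × Eucl m) : ℝ := ‖WithLp.toLp 2 (z - w)‖

/-- The pair of partial gradients `(∇ₓ f(x; y), ∇_y f(x; y))` at `z = (x, y)`. -/
def partialGrads (f : Eucl n → Eucl m → ℝ) (z : Eucl n × Eucl m) : Eucl n × Eucl m :=
  (gradient (fun x => f x z.2) z.1, gradient (fun y => f z.1 y) z.2)

/-- Descent in `x` and ascent in `y` from `z` along the gradient estimate `v`. -/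
def descentAscent (ηx ηy : ℝ) (z v : Eucl n × Eucl m) : Eucl n × Eucl m :=
  (z.1 - ηx • v.1, z.2 + ηy • v.2)

/-- A stochastic gradient oracle: `g j ω z` is the estimate `(g_x(z), g_y(z))` returned by the
`j`-th call, at the query point `z`, for the outcome `ω`. -/
abbrev Oracle (Ω : Type u) (n m : ℕ) : Type u := ℕ → Ω → Eucl n × Eucl m → Eucl n × Eucl m

variable {Ω : Type u}

/-- The iterates of stochastic GDA; step `k` uses oracle call number `k`. -/
def sgda (g : Oracle Ω n m) (ηx ηy : ℝ) (z₀ : Eucl n × Eucl m) : ℕ → Ω → Eucl n × Eucl m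
  | 0, _ => z₀
  | k + 1, ω =>
      descentAscent ηx ηy (sgda g ηx ηy z₀ k ω) (g k ω (sgda g ηx ηy z₀ k ω))

/-- The iterates of stochastic EG; step `k` uses oracle call number `2k` at `z^k`
and oracle call number `2k + 1` at the extrapolated point `z^{k+1/2}`. -/
def seg (g : Oracle Ω n m) (ηx ηy : ℝ) (z₀ : Eucl n × Eucl m) : ℕ → Ω → Eucl n × Eucl m
  | 0, _ => z₀
  | k + 1, ω =>
      descentAscent ηx ηy (seg g ηx ηy z₀ k ω)
        (g (2 * k + 1) ω
          (descentAscent ηx ηy (seg g ηx ηy z₀ k ω) (g (2 * k) ω (seg g ηx ηy z₀ k ω))))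

/-- The extrapolated points `z^{k+1/2}` of stochastic EG. -/
def segHalf (g : Oracle Ω n m) (ηx ηy : ℝ) (z₀ : Eucl n × Eucl m) (k : ℕ) (ω : Ω) :
    Eucl n × Eucl m :=
  descentAscent ηx ηy (seg g ηx ηy z₀ k ω) (g (2 * k) ω (seg g ηx ηy z₀ k ω))

/-- The query point of the `j`-th oracle call of stochastic EG, i.e. `z^{j/2}`. -/
def segQuery (g : Oracle Ω n m) (ηx ηy : ℝ) (z₀ : Eucl n × Eucl m) (j : ℕ) (ω : Ω) :
    Eucl n × Eucl m :=
  if j % 2 = 0 then seg g ηx ηy z₀ (j / 2) ω else segHalf g ηx ηy z₀ (j / 2) ω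

/-- The gradient noise `(ξ_x, ξ_y) = (g_x(z) - ∇ₓ f(z), g_y(z) - ∇_y f(z))` of the `j`-th oracle
call, made at the (random) query point `q j`. -/
def gradNoise (f : Eucl n → Eucl m → ℝ) (g : Oracle Ω n m) (q : ℕ → Ω → Eucl n × Eucl m)
    (j : ℕ) (ω : Ω) : Eucl n × Eucl m :=
  g j ω (q j ω) - partialGrads f (q j ω)

/-- The assumption on the gradient noise, for mini-batches of size `S`: zero mean, second moments
at most `σ²/S`, and independence of the noises of different calls. -/
structure NoiseAssumption [MeasurableSpace Ω] (ν : Measure Ω) (ξ : ℕ → Ω → Eucl n × Eucl m)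
    (σ : ℝ) (S : ℕ) : Prop where
  memLp_x : ∀ j, MemLp (fun ω => (ξ j ω).1) 2 ν
  memLp_y : ∀ j, MemLp (fun ω => (ξ j ω).2) 2 ν
  mean_x : ∀ j, ∫ ω, (ξ j ω).1 ∂ν = 0
  mean_y : ∀ j, ∫ ω, (ξ j ω).2 ∂ν = 0
  second_moment_x : ∀ j, ∫ ω, ‖(ξ j ω).1‖ ^ 2 ∂ν ≤ σ ^ 2 / S
  second_moment_y : ∀ j, ∫ ω, ‖(ξ j ω).2‖ ^ 2 ∂ν ≤ σ ^ 2 / S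
  indep : iIndepFun ξ ν

end QuadMinimax

end

/-!
In the coordinates `P (z - z*)` both methods are linear recursions `Z_{k+1} = G Z_k + noise`, where
`G = 1 + H` for SGDA, `G = 1 + H + H²` for stochastic EG, and `H = η_x J`. Every eigenvalue `w` of
`M` satisfies `Re w ≤ -μ_x / 2` and `|w|² ≤ 4 r L |Re w|`. For real `w` this comes from the Schur
complement: the second row of the eigenvector equation solves for `v` in terms of `u` up to a small
error. For nonreal `w` the imaginary parts of the two rows force `‖v‖² = r ‖u‖²`, after which the
real parts suffice. Hence the diagonal part of `G` contracts at rate `1 - Ω(1 / (r κ_x))`, and the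
superdiagonal part of `J`, of norm at most `δ`, does not spoil this. As the noises are uncorrelated,
their second moments accumulate only as a geometric series.
-/

noncomputable section

namespace QuadMinimax

section Complexification

open scoped ComplexOrder MatrixOrder

variable {ι κ : Type*} [Fintype ι] [Fintype κ]

theorem posSemidef_map_ofReal {ι : Type*} [Finite ι] {A : Matrix ι ι ℝ} (hA : A.PosSemidef) :
    (A.map Complex.ofRealHom).PosSemidef := by
  classical
  have := Fintype.ofFinite ι
  obtain ⟨X, rfl⟩ := CStarAlgebra.nonneg_iff_eq_star_mul_self.mp hA.nonneg
  rw [Matrix.star_eq_conjTranspose, Matrix.map_mul,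
    Matrix.conjTranspose_map Complex.ofRealHom fun x => (Complex.conj_ofReal x).symm]
  exact Matrix.posSemidef_conjTranspose_mul_self _

omit [Fintype ι] [Fintype κ] in
theorem map_ofReal_smul (c : ℝ) (A : Matrix ι κ ℝ) :
    (c • A).map Complex.ofRealHom = c • A.map Complex.ofRealHom :=
  Matrix.map_smul _ c (fun a => by simp) A

theorem norm_map_ofReal_le_of_posSemidef [DecidableEq ι] {A : Matrix ι ι ℝ} {L : ℝ} (hL : 0 ≤ L)
    (hA : A.PosSemidef) (hAL : (L • (1 : Matrix ι ι ℝ) - A).PosSemidef) :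
    ‖A.map Complex.ofRealHom‖ ≤ L := by
  rw [CStarAlgebra.norm_le_iff_le_algebraMap _ hL (posSemidef_map_ofReal hA).nonneg,
    Matrix.le_iff, Algebra.algebraMap_eq_smul_one,
    ← Matrix.map_one Complex.ofRealHom (map_zero _) (map_one _), ← map_ofReal_smul,
    ← Matrix.map_sub _ (map_sub Complex.ofRealHom)]
  exact posSemidef_map_ofReal hAL

theorem norm_sq_eq_re_add_im (w : ι → ℂ) :
    ‖WithLp.toLp 2 w‖ ^ 2
      = ‖WithLp.toLp 2 fun i => (w i).re‖ ^ 2 + ‖WithLp.toLp 2 fun i => (w i).im‖ ^ 2 := by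
  simp only [EuclideanSpace.norm_sq_eq, ← Finset.sum_add_distrib, Complex.sq_norm,
    Complex.normSq_apply, Real.norm_eq_abs, sq_abs, ← pow_two]

theorem norm_map_ofReal_le [DecidableEq κ] (B : Matrix ι κ ℝ) :
    ‖B.map Complex.ofRealHom‖ ≤ ‖B‖ := by
  refine ContinuousLinearMap.opNorm_le_bound _ (norm_nonneg _) fun w => ?_
  let x : κ → ℝ := fun j => (w j).re
  let y : κ → ℝ := fun j => (w j).im
  have hw : ‖w‖ ^ 2 = ‖WithLp.toLp 2 x‖ ^ 2 + ‖WithLp.toLp 2 y‖ ^ 2 :=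
    norm_sq_eq_re_add_im w.ofLp
  have hBw : ‖WithLp.toLp 2 (B.map Complex.ofRealHom *ᵥ w.ofLp)‖ ^ 2
      = ‖WithLp.toLp 2 (B *ᵥ x)‖ ^ 2 + ‖WithLp.toLp 2 (B *ᵥ y)‖ ^ 2 := by
    have hre : (fun i => ((B.map Complex.ofRealHom *ᵥ w.ofLp) i).re) = B *ᵥ x := by
      ext i; simp [Matrix.mulVec, dotProduct, x]
    have him : (fun i => ((B.map Complex.ofRealHom *ᵥ w.ofLp) i).im) = B *ᵥ y := by
      ext i; simp [Matrix.mulVec, dotProduct, y]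
    rw [norm_sq_eq_re_add_im, hre, him]
  refine (pow_le_pow_iff_left₀ (norm_nonneg _) (by positivity) two_ne_zero).mp ?_
  calc ‖WithLp.toLp 2 (B.map Complex.ofRealHom *ᵥ w.ofLp)‖ ^ 2
      = ‖WithLp.toLp 2 (B *ᵥ x)‖ ^ 2 + ‖WithLp.toLp 2 (B *ᵥ y)‖ ^ 2 := hBw
    _ ≤ (‖B‖ * ‖WithLp.toLp 2 x‖) ^ 2 + (‖B‖ * ‖WithLp.toLp 2 y‖) ^ 2 := by
        gcongr
        · exact Matrix.l2_opNorm_mulVec B (WithLp.toLp 2 x)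
        · exact Matrix.l2_opNorm_mulVec B (WithLp.toLp 2 y)
    _ = (‖B‖ * ‖w‖) ^ 2 := by rw [mul_pow ‖B‖ ‖w‖, hw]; ring

end Complexification

section Spectrum

open scoped InnerProductSpace

variable {E F : Type*} [NormedAddCommGroup E] [InnerProductSpace ℂ E] [NormedAddCommGroup F]
  [InnerProductSpace ℂ F]

/-- The assumptions on a quadratic nonconvex-strongly-concave function, for operators between
complex inner product spaces: `A ≥ μ` and the Schur complement `C + B A⁻¹ B' ≥ μx`, where `B'` is
the adjoint of `B`. The Schur complement is encoded through solutions `y` of `A y = B' u`. -/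
structure IsSaddleOperator (A : F →ₗ[ℂ] F) (B : F →ₗ[ℂ] E) (B' : E →ₗ[ℂ] F) (C : E →ₗ[ℂ] E)
    (L μ μx : ℝ) : Prop where
  symm_A : A.IsSymmetric
  symm_C : C.IsSymmetric
  adjoint : ∀ u v, ⟪B' u, v⟫_ℂ = ⟪u, B v⟫_ℂ
  mu_pos : 0 < μ
  mux_pos : 0 < μx
  mux_le_L : μx ≤ L
  mu_le_A : ∀ v, μ * ‖v‖ ^ 2 ≤ (⟪v, A v⟫_ℂ).re
  norm_A_le : ∀ v, ‖A v‖ ≤ L * ‖v‖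
  norm_B_le : ∀ v, ‖B v‖ ≤ L * ‖v‖
  norm_B'_le : ∀ u, ‖B' u‖ ≤ L * ‖u‖
  norm_C_le : ∀ u, ‖C u‖ ≤ L * ‖u‖
  mux_le_schur : ∀ u, ∃ y, A y = B' u ∧ μx * ‖u‖ ^ 2 ≤ (⟪u, C u⟫_ℂ).re + (⟪B' u, y⟫_ℂ).re

theorem mul_re_inner_le_norm_sq_of_coercive {A : F →ₗ[ℂ] F} {μ : ℝ} (hμ : 0 < μ)
    (hA : ∀ v, μ * ‖v‖ ^ 2 ≤ (⟪v, A v⟫_ℂ).re) (d : F) :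
    μ * (⟪d, A d⟫_ℂ).re ≤ ‖A d‖ ^ 2 := by
  have hle : (⟪d, A d⟫_ℂ).re ≤ ‖d‖ * ‖A d‖ := re_inner_le_norm (𝕜 := ℂ) d (A d)
  have hμd : μ * ‖d‖ ≤ ‖A d‖ := by
    rcases (norm_nonneg d).eq_or_lt with h0 | hpos
    · rw [← h0, mul_zero]
      exact norm_nonneg _
    · refine le_of_mul_le_mul_left ?_ hpos
      linarith [hA d]
  calc μ * (⟪d, A d⟫_ℂ).re ≤ μ * ‖d‖ * ‖A d‖ := by rw [mul_assoc]; gcongr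
    _ ≤ ‖A d‖ ^ 2 := by rw [sq]; gcongr

namespace IsSaddleOperator

variable {A : F →ₗ[ℂ] F} {B : F →ₗ[ℂ] E} {B' : E →ₗ[ℂ] F} {C : E →ₗ[ℂ] E} {L μ μx r : ℝ}

theorem L_pos (h : IsSaddleOperator A B B' C L μ μx) : 0 < L := h.mux_pos.trans_le h.mux_le_L

theorem neg_le_re_inner_C (h : IsSaddleOperator A B B' C L μ μx) (u : E) :
    -(L * ‖u‖ ^ 2) ≤ (⟪u, C u⟫_ℂ).re := by
  have hle : |(⟪u, C u⟫_ℂ).re| ≤ ‖u‖ * ‖C u‖ :=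
    (Complex.abs_re_le_norm _).trans (norm_inner_le_norm u (C u))
  nlinarith [neg_abs_le (⟪u, C u⟫_ℂ).re, h.norm_C_le u, norm_nonneg u]

theorem re_inner_C_le (h : IsSaddleOperator A B B' C L μ μx) (u : E) :
    (⟪u, C u⟫_ℂ).re ≤ L * ‖u‖ ^ 2 := by
  have hle : (⟪u, C u⟫_ℂ).re ≤ ‖u‖ * ‖C u‖ := re_inner_le_norm (𝕜 := ℂ) u (C u)
  nlinarith [h.norm_C_le u, norm_nonneg u]

theorem schur_le_of_eq_add_smul (h : IsSaddleOperator A B B' C L μ μx) {u : E} {v : F} {s : ℝ}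
    (hv : B' u = A v + (s : ℂ) • v) :
    μ * (μx * ‖u‖ ^ 2) ≤
      μ * ((⟪u, C u⟫_ℂ).re + (⟪u, B v⟫_ℂ).re) + s * ((μ + s) * ‖v‖ ^ 2) := by
  obtain ⟨y, hy, hschur⟩ := h.mux_le_schur u
  -- The solution `y` of `A y = B' u` differs from `v` by some `d` with `A d = s • v`, and the
  -- contribution `⟪d, A d⟫` of `d` to the Schur complement is at most `s² ‖v‖² / μ`.
  have hd : A (y - v) = (s : ℂ) • v := by rw [map_sub, hy, hv, add_sub_cancel_left]
  have hq := mul_re_inner_le_norm_sq_of_coercive h.mu_pos h.mu_le_A (y - v)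
  rw [hd, norm_smul, mul_pow, Complex.norm_real, Real.norm_eq_abs, sq_abs] at hq
  have hvd : (⟪A v, y - v⟫_ℂ).re = s * ‖v‖ ^ 2 := by
    rw [h.symm_A, hd, inner_smul_right, Complex.re_ofReal_mul]
    exact congrArg (s * ·) (inner_self_eq_norm_sq (𝕜 := ℂ) v)
  have hdd : ⟪(s : ℂ) • v, y - v⟫_ℂ = ⟪y - v, (s : ℂ) • v⟫_ℂ := by rw [← hd, h.symm_A]
  have hsplit : (⟪B' u, y⟫_ℂ).re = (⟪u, B v⟫_ℂ).re + s * ‖v‖ ^ 2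
      + (⟪y - v, (s : ℂ) • v⟫_ℂ).re := by
    have hy' : ⟪B' u, y⟫_ℂ = ⟪B' u, v⟫_ℂ + ⟪B' u, y - v⟫_ℂ := by
      rw [← inner_add_right, add_sub_cancel]
    rw [hy', h.adjoint, hv, inner_add_left, hdd, Complex.add_re, Complex.add_re, hvd, add_assoc]
  rw [hsplit] at hschur
  linarith [mul_le_mul_of_nonneg_left hschur h.mu_pos.le]

end IsSaddleOperator

/-- `(u, v)` is an eigenvector of `[[-C, -B], [r B', -r A]]` for the eigenvalue `z`. -/
structure IsSaddleEigenvector (A : F →ₗ[ℂ] F) (B : F →ₗ[ℂ] E) (B' : E →ₗ[ℂ] F) (C : E →ₗ[ℂ] E)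
    (r : ℝ) (z : ℂ) (u : E) (v : F) : Prop where
  fst_eq : -(C u) - B v = z • u
  snd_eq : (r : ℂ) • (B' u - A v) = z • v
  ne_zero : u ≠ 0 ∨ v ≠ 0

namespace IsSaddleEigenvector

variable {A : F →ₗ[ℂ] F} {B : F →ₗ[ℂ] E} {B' : E →ₗ[ℂ] F} {C : E →ₗ[ℂ] E} {L μ μx r : ℝ}
  {z : ℂ} {u : E} {v : F}

theorem norm_sq_pos (he : IsSaddleEigenvector A B B' C r z u v) : 0 < ‖u‖ ^ 2 + ‖v‖ ^ 2 := by
  rcases he.ne_zero with hu | hv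
  · have := norm_pos_iff.mpr hu
    positivity
  · have := norm_pos_iff.mpr hv
    positivity

theorem mul_norm_sq_fst (he : IsSaddleEigenvector A B B' C r z u v) :
    z * (‖u‖ ^ 2 : ℝ) = -⟪u, C u⟫_ℂ - ⟪u, B v⟫_ℂ := by
  have := congrArg (fun w => ⟪u, w⟫_ℂ) he.fst_eq
  simp only [inner_sub_right, inner_neg_right, inner_smul_right,
    inner_self_eq_norm_sq_to_K] at this
  rw [this]
  norm_cast

theorem mul_norm_sq_snd (h : IsSaddleOperator A B B' C L μ μx)
    (he : IsSaddleEigenvector A B B' C r z u v) :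
    z * (‖v‖ ^ 2 : ℝ) = r * ((starRingEnd ℂ) ⟪u, B v⟫_ℂ - ⟪v, A v⟫_ℂ) := by
  have := congrArg (fun w => ⟪v, w⟫_ℂ) he.snd_eq
  simp only [inner_sub_right, inner_smul_right, inner_self_eq_norm_sq_to_K] at this
  rw [← h.adjoint, inner_conj_symm, this]
  norm_cast

theorem re_mul_norm_sq_fst (he : IsSaddleEigenvector A B B' C r z u v) :
    z.re * ‖u‖ ^ 2 = -(⟪u, C u⟫_ℂ).re - (⟪u, B v⟫_ℂ).re := by
  simpa only [Complex.re_mul_ofReal, Complex.sub_re, Complex.neg_re] using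
    congrArg Complex.re he.mul_norm_sq_fst

theorem re_mul_norm_sq_snd (h : IsSaddleOperator A B B' C L μ μx)
    (he : IsSaddleEigenvector A B B' C r z u v) :
    z.re * ‖v‖ ^ 2 = r * ((⟪u, B v⟫_ℂ).re - (⟪v, A v⟫_ℂ).re) := by
  simpa only [Complex.re_mul_ofReal, Complex.re_ofReal_mul, Complex.sub_re, Complex.conj_re] using
    congrArg Complex.re (he.mul_norm_sq_snd h)

theorem im_mul_norm_sq_fst (h : IsSaddleOperator A B B' C L μ μx)
    (he : IsSaddleEigenvector A B B' C r z u v) :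
    z.im * ‖u‖ ^ 2 = -(⟪u, B v⟫_ℂ).im := by
  have hC : (⟪u, C u⟫_ℂ).im = 0 := h.symm_C.im_inner_self_apply u
  simpa only [Complex.im_mul_ofReal, Complex.sub_im, Complex.neg_im, hC, neg_zero, zero_sub] using
    congrArg Complex.im he.mul_norm_sq_fst

theorem im_mul_norm_sq_snd (h : IsSaddleOperator A B B' C L μ μx)
    (he : IsSaddleEigenvector A B B' C r z u v) :
    z.im * ‖v‖ ^ 2 = -(r * (⟪u, B v⟫_ℂ).im) := by
  have hA : (⟪v, A v⟫_ℂ).im = 0 := h.symm_A.im_inner_self_apply v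
  simpa only [Complex.im_mul_ofReal, Complex.im_ofReal_mul, Complex.sub_im, Complex.conj_im, hA,
    sub_zero, mul_neg] using congrArg Complex.im (he.mul_norm_sq_snd h)

theorem mul_add_mux_le_of_real (h : IsSaddleOperator A B B' C L μ μx) (hr : r ≠ 0) {s : ℝ}
    (he : IsSaddleEigenvector A B B' C r (r * s : ℝ) u v) :
    μ * ((r * s + μx) * ‖u‖ ^ 2) ≤ s * ((μ + s) * ‖v‖ ^ 2) := by
  have hB'u : B' u = A v + (s : ℂ) • v := by
    have := he.snd_eq
    rw [Complex.ofReal_mul, mul_smul] at this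
    rw [← smul_right_injective F (Complex.ofReal_ne_zero.mpr hr) this, add_sub_cancel]
  have hu := he.re_mul_norm_sq_fst
  rw [Complex.ofReal_re] at hu
  linarith [h.schur_le_of_eq_add_smul hB'u, congrArg (μ * ·) hu]

theorem add_mul_norm_sq_snd_le_of_real (h : IsSaddleOperator A B B' C L μ μx) (hr : r ≠ 0) {s : ℝ}
    (he : IsSaddleEigenvector A B B' C r (r * s : ℝ) u v) :
    (μ + s) * ‖v‖ ^ 2 ≤ (L - r * s) * ‖u‖ ^ 2 := by
  have hu := he.re_mul_norm_sq_fst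
  have hv := he.re_mul_norm_sq_snd h
  rw [Complex.ofReal_re] at hu hv
  rw [mul_assoc] at hv
  linarith [mul_left_cancel₀ hr hv, h.mu_le_A v, h.neg_le_re_inner_C u]

theorem le_neg_mux_of_real (h : IsSaddleOperator A B B' C L μ μx) (hr : 2 * L ≤ r * μ) {s : ℝ}
    (he : IsSaddleEigenvector A B B' C r (r * s : ℝ) u v) : r * s ≤ -μx := by
  have hL := h.L_pos
  have hμ := h.mu_pos
  have hμx := h.mux_pos
  have hr0 : 0 < r := pos_of_mul_pos_left (by linarith) hμ.le
  have hschur := he.mul_add_mux_le_of_real h hr0.ne'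
  have hpos := he.norm_sq_pos
  by_contra! hlt
  rcases lt_or_ge s 0 with hneg | hnonneg
  · have hμs : 0 < μ + s := by nlinarith [h.mux_le_L]
    have hu : 0 < ‖u‖ ^ 2 := by
      by_contra hle
      have hu0 : ‖u‖ ^ 2 = 0 := le_antisymm (not_lt.mp hle) (sq_nonneg _)
      rw [hu0, mul_zero, mul_zero] at hschur
      linarith [mul_neg_of_neg_of_pos hneg (mul_pos hμs (show 0 < ‖v‖ ^ 2 by linarith))]
    linarith [mul_pos hμ (mul_pos (show 0 < r * s + μx by linarith) hu),
      mul_nonpos_of_nonpos_of_nonneg hneg.le (mul_nonneg hμs.le (sq_nonneg ‖v‖))]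
  · have hv := he.add_mul_norm_sq_snd_le_of_real h hr0.ne'
    have hu : 0 < ‖u‖ ^ 2 := by
      by_contra hle
      have hu0 : ‖u‖ ^ 2 = 0 := le_antisymm (not_lt.mp hle) (sq_nonneg _)
      have : 0 < (μ + s) * ‖v‖ ^ 2 := mul_pos (by linarith) (by linarith)
      rw [hu0, mul_zero] at hv
      linarith
    have hcmp : μ * (r * s + μx) ≤ s * (L - r * s) := by
      refine le_of_mul_le_mul_right ?_ hu
      linarith [mul_le_mul_of_nonneg_left hv hnonneg]
    have hrs : 0 ≤ r * s := mul_nonneg hr0.le hnonneg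
    linarith [mul_pos hμ hμx, mul_nonneg hnonneg hrs, mul_le_mul_of_nonneg_right hr hnonneg,
      mul_nonneg hμ.le hrs, mul_nonneg hL.le hnonneg]

theorem norm_sq_snd_eq_of_im_ne_zero (h : IsSaddleOperator A B B' C L μ μx)
    (he : IsSaddleEigenvector A B B' C r z u v) (hz : z.im ≠ 0) : ‖v‖ ^ 2 = r * ‖u‖ ^ 2 := by
  refine mul_left_cancel₀ hz ?_
  linear_combination he.im_mul_norm_sq_snd h - r * he.im_mul_norm_sq_fst h

theorem norm_fst_pos_of_im_ne_zero (h : IsSaddleOperator A B B' C L μ μx)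
    (he : IsSaddleEigenvector A B B' C r z u v) (hz : z.im ≠ 0) : 0 < ‖u‖ ^ 2 := by
  refine lt_of_le_of_ne (sq_nonneg _) fun hu => he.norm_sq_pos.ne' ?_
  rw [he.norm_sq_snd_eq_of_im_ne_zero h hz, ← hu, mul_zero, add_zero]

theorem two_mul_le_re_inner_A_of_im_ne_zero (h : IsSaddleOperator A B B' C L μ μx)
    (hr : 2 * L ≤ r * μ) (he : IsSaddleEigenvector A B B' C r z u v) (hz : z.im ≠ 0) :
    2 * L * ‖u‖ ^ 2 ≤ (⟪v, A v⟫_ℂ).re :=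
  calc 2 * L * ‖u‖ ^ 2 ≤ r * μ * ‖u‖ ^ 2 := by gcongr
    _ = μ * ‖v‖ ^ 2 := by rw [he.norm_sq_snd_eq_of_im_ne_zero h hz]; ring
    _ ≤ (⟪v, A v⟫_ℂ).re := h.mu_le_A v

theorem re_mul_norm_sq_fst_of_im_ne_zero (h : IsSaddleOperator A B B' C L μ μx) (hr : r ≠ 0)
    (he : IsSaddleEigenvector A B B' C r z u v) (hz : z.im ≠ 0) :
    z.re * ‖u‖ ^ 2 = (⟪u, B v⟫_ℂ).re - (⟪v, A v⟫_ℂ).re := by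
  have := he.re_mul_norm_sq_snd h
  rw [he.norm_sq_snd_eq_of_im_ne_zero h hz, mul_left_comm] at this
  exact mul_left_cancel₀ hr this

theorem re_le_of_im_ne_zero (h : IsSaddleOperator A B B' C L μ μx) (hr : 2 * L ≤ r * μ)
    (hr0 : r ≠ 0) (he : IsSaddleEigenvector A B B' C r z u v) (hz : z.im ≠ 0) :
    z.re ≤ -(L / 2) := by
  refine le_of_mul_le_mul_right ?_ (he.norm_fst_pos_of_im_ne_zero h hz)
  linarith [he.two_mul_le_re_inner_A_of_im_ne_zero h hr hz, h.neg_le_re_inner_C u,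
    he.re_mul_norm_sq_fst, he.re_mul_norm_sq_fst_of_im_ne_zero h hr0 hz]

theorem norm_inner_sq_le_of_im_ne_zero (h : IsSaddleOperator A B B' C L μ μx)
    (he : IsSaddleEigenvector A B B' C r z u v) (hz : z.im ≠ 0) :
    ‖⟪u, B v⟫_ℂ‖ ^ 2 ≤ L ^ 2 * r * (‖u‖ ^ 2) ^ 2 :=
  calc ‖⟪u, B v⟫_ℂ‖ ^ 2 ≤ (‖u‖ * (L * ‖v‖)) ^ 2 := by
        gcongr
        exact (norm_inner_le_norm _ _).trans (by gcongr; exact h.norm_B_le v)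
    _ = L ^ 2 * ‖u‖ ^ 2 * ‖v‖ ^ 2 := by ring
    _ = L ^ 2 * r * (‖u‖ ^ 2) ^ 2 := by rw [he.norm_sq_snd_eq_of_im_ne_zero h hz]; ring

theorem norm_sq_le_of_im_ne_zero (h : IsSaddleOperator A B B' C L μ μx) (hr : 2 * L ≤ r * μ)
    (hr2 : 2 ≤ r) (he : IsSaddleEigenvector A B B' C r z u v) (hz : z.im ≠ 0) :
    ‖z‖ ^ 2 ≤ 4 * r * L * -z.re := by
  have hL := h.L_pos
  have hU := he.norm_fst_pos_of_im_ne_zero h hz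
  have ha := he.two_mul_le_re_inner_A_of_im_ne_zero h hr hz
  have hc := h.neg_le_re_inner_C u
  have hc' := h.re_inner_C_le u
  have hb := he.norm_inner_sq_le_of_im_ne_zero h hz
  have hre := he.re_mul_norm_sq_fst
  have hre' := he.re_mul_norm_sq_fst_of_im_ne_zero h (by linarith) hz
  have him := he.im_mul_norm_sq_fst h
  rw [Complex.sq_norm, Complex.normSq_apply] at hb ⊢
  generalize (⟪u, B v⟫_ℂ).re = p at *
  generalize (⟪u, B v⟫_ℂ).im = q at *
  generalize (⟪v, A v⟫_ℂ).re = a at *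
  generalize (⟪u, C u⟫_ℂ).re = c at *
  generalize ‖u‖ ^ 2 = U at *
  have hdet : (z.re * U) ^ 2 + (z.im * U) ^ 2 = c * a + (p * p + q * q) := by
    rw [him]
    linear_combination (z.re * U - p) * hre - c * hre'
  have hca : c * a ≤ L * U * a := by
    gcongr
    exact le_trans (by positivity) ha
  have hLU : 0 < L * U := mul_pos hL hU
  have hLUa : 0 ≤ (r - 2) * (L * U * a) :=
    mul_nonneg (by linarith) (mul_nonneg hLU.le (le_trans (by positivity) ha))
  have hac : 0 ≤ r * (L * U) * (a + 2 * c) := mul_nonneg (by positivity) (by linarith)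
  have haL : 0 ≤ r * (L * U) * (a - 2 * L * U) := mul_nonneg (by positivity) (by linarith)
  refine le_of_mul_le_mul_right ?_ (pow_pos hU 2)
  calc (z.re * z.re + z.im * z.im) * U ^ 2 = c * a + (p * p + q * q) := by
        rw [← hdet]; ring
    _ ≤ 2 * r * L * U * (a + c) := by linarith
    _ = 4 * r * L * -z.re * U ^ 2 := by linear_combination 2 * r * L * U * (hre + hre')

theorem norm_le (h : IsSaddleOperator A B B' C L μ μx) (hr : 0 ≤ r)
    (he : IsSaddleEigenvector A B B' C r z u v) : ‖z‖ ≤ (1 + r) * L := by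
  have hu : ‖z‖ * ‖u‖ ≤ L * ‖u‖ + L * ‖v‖ := by
    rw [← norm_smul, ← he.fst_eq]
    refine (norm_sub_le _ _).trans (add_le_add ?_ (h.norm_B_le v))
    rw [norm_neg]
    exact h.norm_C_le u
  have hv : ‖z‖ * ‖v‖ ≤ r * (L * ‖u‖ + L * ‖v‖) := by
    rw [← norm_smul, ← he.snd_eq, norm_smul, Complex.norm_real, Real.norm_of_nonneg hr]
    gcongr
    exact (norm_sub_le _ _).trans (add_le_add (h.norm_B'_le u) (h.norm_A_le v))
  have hpos : 0 < ‖u‖ + ‖v‖ := by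
    rcases he.ne_zero with hne | hne
    · exact add_pos_of_pos_of_nonneg (norm_pos_iff.mpr hne) (norm_nonneg v)
    · exact add_pos_of_nonneg_of_pos (norm_nonneg u) (norm_pos_iff.mpr hne)
  refine le_of_mul_le_mul_right ?_ hpos
  linarith

theorem re_le_and_norm_sq_le (h : IsSaddleOperator A B B' C L μ μx) (hr : 2 * L ≤ r * μ)
    (hr2 : 2 ≤ r) (he : IsSaddleEigenvector A B B' C r z u v) :
    z.re ≤ -(μx / 2) ∧ ‖z‖ ^ 2 ≤ 4 * r * L * -z.re := by
  have hL := h.L_pos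
  by_cases hz : z.im = 0
  · have hr0 : r ≠ 0 := by linarith
    have hzs : ((r * (z.re / r) : ℝ) : ℂ) = z := by
      rw [mul_div_cancel₀ _ hr0]
      exact Complex.ext rfl hz.symm
    have hre : z.re ≤ -μx := by
      rw [← mul_div_cancel₀ z.re hr0]
      exact le_neg_mux_of_real h hr (hzs ▸ he)
    have hnorm : ‖z‖ = -z.re := by
      rw [← Complex.abs_re_eq_norm.mpr hz, abs_of_nonpos (by linarith [h.mux_pos])]
    have hle : ‖z‖ ≤ 4 * r * L := by
      refine (he.norm_le h (by linarith)).trans ?_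
      gcongr
      linarith
    refine ⟨by linarith [h.mux_pos], ?_⟩
    rw [sq, ← hnorm]
    gcongr
  · refine ⟨(he.re_le_of_im_ne_zero h hr (by linarith) hz).trans ?_,
      he.norm_sq_le_of_im_ne_zero h hr hr2 hz⟩
    linarith [h.mux_le_L]

end IsSaddleEigenvector

end Spectrum

section Eigenvalues

open scoped InnerProductSpace

section ComplexLin

variable {ι κ τ : Type*} [Fintype κ] [DecidableEq κ] [Fintype τ] [DecidableEq τ]

/-- The operator between complex Euclidean spaces given by a real matrix. -/
def complexLin : Matrix ι κ ℝ →ₗ[ℝ] EuclideanSpace ℂ κ →ₗ[ℂ] EuclideanSpace ℂ ι where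
  toFun B := (B.map Complex.ofRealHom).toEuclideanLin
  map_add' B B' := by rw [Matrix.map_add _ (map_add Complex.ofRealHom), map_add]
  map_smul' c B := by
    rw [map_ofReal_smul]
    exact map_smul (Matrix.toEuclideanLin.toLinearMap.restrictScalars ℝ) c _

theorem complexLin_apply (B : Matrix ι κ ℝ) (v : EuclideanSpace ℂ κ) :
    complexLin B v = WithLp.toLp 2 (B.map Complex.ofRealHom *ᵥ v.ofLp) := rfl

theorem complexLin_one : complexLin (1 : Matrix κ κ ℝ) = LinearMap.id := by
  ext
  simp [complexLin_apply]

theorem complexLin_mul_apply (A : Matrix ι κ ℝ) (B : Matrix κ τ ℝ) (v : EuclideanSpace ℂ τ) :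
    complexLin (A * B) v = complexLin A (complexLin B v) := by
  simp only [complexLin_apply, Matrix.map_mul, Matrix.mulVec_mulVec]

theorem norm_complexLin_apply_le [Fintype ι] {B : Matrix ι κ ℝ} {L : ℝ} (hB : ‖B‖ ≤ L)
    (v : EuclideanSpace ℂ κ) : ‖complexLin B v‖ ≤ L * ‖v‖ :=
  (Matrix.l2_opNorm_mulVec (B.map Complex.ofRealHom) v).trans <| by
    gcongr
    exact (norm_map_ofReal_le B).trans hB

theorem inner_complexLin_transpose [Fintype ι] [DecidableEq ι] (B : Matrix ι κ ℝ)
    (u : EuclideanSpace ℂ ι) (v : EuclideanSpace ℂ κ) :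
    ⟪complexLin Bᵀ u, v⟫_ℂ = ⟪u, complexLin B v⟫_ℂ := by
  have hB : Bᵀ.map Complex.ofRealHom = (B.map Complex.ofRealHom)ᴴ := by
    ext
    simp
  change ⟪(Bᵀ.map Complex.ofRealHom).toEuclideanLin u, v⟫_ℂ = _
  rw [hB, Matrix.toEuclideanLin_conjTranspose_eq_adjoint, LinearMap.adjoint_inner_left]
  rfl

theorem mul_norm_sq_le_re_inner_complexLin {A : Matrix κ κ ℝ} {c : ℝ}
    (hA : (A - c • (1 : Matrix κ κ ℝ)).PosSemidef) (v : EuclideanSpace ℂ κ) :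
    c * ‖v‖ ^ 2 ≤ (⟪v, complexLin A v⟫_ℂ).re := by
  have hnonneg : 0 ≤ (⟪v, complexLin (A - c • 1) v⟫_ℂ).re :=
    (Matrix.isPositive_toEuclideanLin_iff.mpr (posSemidef_map_ofReal hA)).re_inner_nonneg_right v
  rw [map_sub, map_smul, complexLin_one, LinearMap.sub_apply, inner_sub_right, LinearMap.smul_apply,
    LinearMap.id_apply, inner_smul_right_eq_smul, Complex.sub_re, Complex.smul_re, sub_nonneg]
    at hnonneg
  rwa [norm_sq_eq_re_inner (𝕜 := ℂ) v]

end ComplexLin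

variable {A : Matrix (Fin m) (Fin m) ℝ} {B : Matrix (Fin n) (Fin m) ℝ}
  {C : Matrix (Fin n) (Fin n) ℝ} {L μ μx r : ℝ}

namespace IsQuadNCSC

theorem L_pos (h : IsQuadNCSC A B C L μ μx) : 0 < L := h.mux_pos.trans_le h.mux_le_L

theorem mu_le_L (h : IsQuadNCSC A B C L μ μx) (hm : 0 < m) : μ ≤ L := by
  have hμ := h.mu_le_A.diag_nonneg (i := ⟨0, hm⟩)
  have hL := h.A_le_L.diag_nonneg (i := ⟨0, hm⟩)
  simp only [Matrix.sub_apply, Matrix.smul_apply, Matrix.one_apply_eq, smul_eq_mul, mul_one]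
    at hμ hL
  linarith

theorem two_le_of_two_mul_div_le (h : IsQuadNCSC A B C L μ μx) (hm : 0 < m)
    (hr : 2 * (L / μ) ≤ r) : 2 ≤ r := by
  linarith [(one_le_div h.mu_pos).mpr (h.mu_le_L hm)]

theorem posDef_A (h : IsQuadNCSC A B C L μ μx) : A.PosDef := by
  rw [← sub_add_cancel A (μ • 1)]
  exact Matrix.PosDef.posSemidef_add h.mu_le_A (Matrix.PosDef.one.smul h.mu_pos)

theorem isSaddleOperator (h : IsQuadNCSC A B C L μ μx) :
    IsSaddleOperator (complexLin A) (complexLin B) (complexLin Bᵀ) (complexLin C) L μ μx where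
  symm_A v w := by
    conv_lhs => rw [← h.symm_A.eq]
    exact inner_complexLin_transpose A v w
  symm_C v w := by
    conv_lhs => rw [← h.symm_C.eq]
    exact inner_complexLin_transpose C v w
  adjoint := inner_complexLin_transpose B
  mu_pos := h.mu_pos
  mux_pos := h.mux_pos
  mux_le_L := h.mux_le_L
  mu_le_A := mul_norm_sq_le_re_inner_complexLin h.mu_le_A
  norm_A_le v := (Matrix.l2_opNorm_mulVec (A.map Complex.ofRealHom) v).trans <| by
    gcongr
    exact norm_map_ofReal_le_of_posSemidef h.L_pos.le h.posDef_A.posSemidef h.A_le_L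
  norm_B_le := norm_complexLin_apply_le h.norm_B_le
  norm_B'_le := norm_complexLin_apply_le <| by
    rw [← Matrix.conjTranspose_eq_transpose_of_trivial, Matrix.l2_opNorm_conjTranspose]
    exact h.norm_B_le
  norm_C_le := norm_complexLin_apply_le h.norm_C_le
  mux_le_schur u := by
    refine ⟨complexLin A⁻¹ (complexLin Bᵀ u), ?_, ?_⟩
    · rw [← complexLin_mul_apply,
        Matrix.mul_nonsing_inv _ (A.isUnit_iff_isUnit_det.mp h.posDef_A.isUnit),
        complexLin_one, LinearMap.id_apply]
    · rw [inner_complexLin_transpose, ← complexLin_mul_apply, ← complexLin_mul_apply,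
        ← Complex.add_re, ← inner_add_right, ← LinearMap.add_apply, ← map_add]
      exact mul_norm_sq_le_re_inner_complexLin h.mux_le_schur u

end IsQuadNCSC

/-- The matrix `M`, over `ℂ` and with the coordinates numbered in the usual order. -/
def complexMat (M : Matrix (Fin n ⊕ Fin m) (Fin n ⊕ Fin m) ℝ) :
    Matrix (Fin (n + m)) (Fin (n + m)) ℂ :=
  (Matrix.reindex finSumFinEquiv finSumFinEquiv M).map fun t : ℝ => (t : ℂ)

theorem complexMat_mulVec_comp (M : Matrix (Fin n ⊕ Fin m) (Fin n ⊕ Fin m) ℝ)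
    (w : Fin (n + m) → ℂ) :
    (complexMat M *ᵥ w) ∘ finSumFinEquiv
      = M.map Complex.ofRealHom *ᵥ (w ∘ finSumFinEquiv) := by
  ext k
  simp only [complexMat, Function.comp_apply, Matrix.mulVec, dotProduct]
  rw [← finSumFinEquiv.sum_comp]
  simp only [Matrix.map_apply, Matrix.reindex_apply, Matrix.submatrix_apply,
    Equiv.symm_apply_apply, Complex.ofRealHom_eq_coe]

theorem isSaddleEigenvector_of_mulVec_eq {w : Fin (n + m) → ℂ} {z : ℂ} (hw : w ≠ 0)
    (hMw : complexMat (matM A B C r) *ᵥ w = z • w) :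
    IsSaddleEigenvector (complexLin A) (complexLin B) (complexLin Bᵀ) (complexLin C) r z
      (WithLp.toLp 2 (w ∘ Fin.castAdd m)) (WithLp.toLp 2 (w ∘ Fin.natAdd n)) := by
  have hblocks := complexMat_mulVec_comp (matM A B C r) w
  have hsum : w ∘ finSumFinEquiv = Sum.elim (w ∘ Fin.castAdd m) (w ∘ Fin.natAdd n) := by
    ext (i | i) <;> simp
  rw [hMw, matM, Matrix.fromBlocks_map, hsum, Matrix.fromBlocks_mulVec] at hblocks
  refine ⟨?_, ?_, ?_⟩
  · ext i
    have := congrFun hblocks (Sum.inl i)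
    simpa [complexLin_apply, Matrix.neg_mulVec, Matrix.map_neg, sub_eq_add_neg] using this.symm
  · ext i
    have := congrFun hblocks (Sum.inr i)
    simpa [complexLin_apply, map_ofReal_smul, Matrix.smul_mulVec, Matrix.neg_mulVec,
      Matrix.map_neg, sub_eq_add_neg] using this.symm
  · by_contra! hzero
    refine hw (funext fun k => ?_)
    obtain ⟨i | i, rfl⟩ := finSumFinEquiv.surjective k
    · exact congrArg (fun x : EuclideanSpace ℂ (Fin n) => x i) hzero.1
    · exact congrArg (fun x : EuclideanSpace ℂ (Fin m) => x i) hzero.2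

theorem IsQuadNCSC.eigenvalue_bounds (h : IsQuadNCSC A B C L μ μx) (hm : 0 < m)
    (hr : 2 * (L / μ) ≤ r) {w : Fin (n + m) → ℂ} {z : ℂ} (hw : w ≠ 0)
    (hMw : complexMat (matM A B C r) *ᵥ w = z • w) :
    z.re ≤ -(μx / 2) ∧ ‖z‖ ^ 2 ≤ 4 * r * L * -z.re ∧ ‖z‖ ≤ (1 + r) * L := by
  have he := isSaddleEigenvector_of_mulVec_eq hw hMw
  have hr2 := h.two_le_of_two_mul_div_le hm hr
  have hrμ : 2 * L ≤ r * μ := by rwa [mul_div_assoc', div_le_iff₀ h.mu_pos] at hr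
  obtain ⟨hre, hsq⟩ := he.re_le_and_norm_sq_le h.isSaddleOperator hrμ hr2
  exact ⟨hre, hsq, he.norm_le h.isSaddleOperator (by linarith)⟩

end Eigenvalues

section Triangular

variable {N : ℕ} {M P J : Matrix (Fin N) (Fin N) ℂ} {δ : ℝ}

/-- `M = P⁻¹ J P` with `J` upper triangular, up to a strictly upper triangular part of spectral
norm at most `δ`: the form in which a Jordan decomposition enters the convergence proof. -/
structure IsTriangularDecomp (M P J : Matrix (Fin N) (Fin N) ℂ) (δ : ℝ) : Prop where
  isUnit_det : IsUnit P.det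
  isUpperTriangular : J.IsUpperTriangular
  norm_sub_diagonal_le : ‖J - Matrix.diagonal J.diag‖ ≤ δ
  eq : M = P⁻¹ * J * P

theorem IsTriangularDecomp.exists_eigenvector (h : IsTriangularDecomp M P J δ) (i : Fin N) :
    ∃ w ≠ 0, M *ᵥ w = J i i • w := by
  have hJ : (J i i • (1 : Matrix (Fin N) (Fin N) ℂ) - J).det = 0 := by
    rw [Matrix.det_of_isUpperTriangular]
    · exact Finset.prod_eq_zero (Finset.mem_univ i) (by simp)
    · intro k l hlk
      have hne : k ≠ l := ne_of_gt hlk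
      simp [h.isUpperTriangular hlk, Matrix.one_apply_ne hne]
  have hM : (J i i • (1 : Matrix (Fin N) (Fin N) ℂ) - M).det = 0 := by
    have hconj : J i i • (1 : Matrix (Fin N) (Fin N) ℂ) - M = P⁻¹ * (J i i • 1 - J) * P := by
      rw [h.eq, Matrix.mul_sub, Matrix.sub_mul, Matrix.mul_smul, mul_one, Matrix.smul_mul,
        Matrix.nonsing_inv_mul _ h.isUnit_det]
    rw [hconj, Matrix.det_mul, Matrix.det_mul, hJ, mul_zero, zero_mul]
  obtain ⟨w, hw, hw0⟩ := Matrix.exists_mulVec_eq_zero_iff.mpr hM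
  refine ⟨w, hw, ?_⟩
  rw [Matrix.sub_mulVec, sub_eq_zero, Matrix.smul_mulVec, Matrix.one_mulVec] at hw0
  exact hw0.symm

theorem norm_diagonal_le {ι : Type*} [Fintype ι] [DecidableEq ι] {d : ι → ℂ} {a : ℝ} (ha : 0 ≤ a)
    (hd : ∀ i, ‖d i‖ ≤ a) : ‖Matrix.diagonal d‖ ≤ a := by
  rw [Matrix.l2_opNorm_diagonal]
  exact (pi_norm_le_iff_of_nonneg ha).mpr hd

theorem norm_le_of_forall_ne_perm_eq_zero {ι : Type*} [Fintype ι] [DecidableEq ι]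
    {S : Matrix ι ι ℂ} (e : Equiv.Perm ι) (hδ : 0 ≤ δ) (hS : ∀ i j, e i ≠ j → S i j = 0)
    (hSe : ∀ i, ‖S i (e i)‖ ≤ δ) : ‖S‖ ≤ δ := by
  have hmul : S = Matrix.diagonal (fun i => S i (e i)) * e.permMatrix ℂ := by
    ext i j
    by_cases hij : e i = j
    · simp [Matrix.diagonal_mul, hij]
    · simp [Matrix.diagonal_mul, hij, hS i j hij]
  rw [hmul]
  calc _ ≤ ‖Matrix.diagonal fun i => S i (e i)‖ * ‖e.permMatrix ℂ‖ := norm_mul_le _ _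
    _ ≤ δ * 1 := by
      gcongr
      · exact norm_diagonal_le hδ hSe
      · exact Matrix.permMatrix_l2_opNorm_le e
    _ = δ := mul_one δ

theorem IsJordanForm.norm_sub_diagonal_le (hJ : IsJordanForm J δ) (hδ : 0 ≤ δ) :
    ‖J - Matrix.diagonal J.diag‖ ≤ δ := by
  have hdiag : ∀ i, (J - Matrix.diagonal J.diag) i i = 0 := fun i => by simp
  have hoff : ∀ i j, i ≠ j → (J - Matrix.diagonal J.diag) i j = J i j := fun i j hij => by
    simp [hij]
  have hval : ∀ i j : Fin N, (j : ℕ) ≠ i + 1 → (J - Matrix.diagonal J.diag) i j = 0 := by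
    intro i j hj
    by_cases hij : i = j
    · rw [← hij, hdiag]
    · rw [hoff i j hij]
      exact hJ.off_eq_zero i j (fun h => hij (Fin.ext h.symm)) hj
  refine norm_le_of_forall_ne_perm_eq_zero (finRotate N) hδ (fun i j hij => hval i j ?_) fun i => ?_
  · intro hj
    refine hij (Fin.ext ?_)
    have hi : (i : ℕ) + 1 < N := hj ▸ j.isLt
    obtain ⟨k, rfl⟩ : ∃ k, N = k + 1 := ⟨N - 1, by omega⟩
    rw [hj, coe_finRotate_of_ne_last (fun h => by simp [h] at hi)]
  · by_cases hij : i = finRotate N i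
    · rw [← hij, hdiag, norm_zero]
      exact hδ
    by_cases hj : (finRotate N i : ℕ) = i + 1
    · rw [hoff _ _ hij]
      obtain h0 | ⟨h1, -⟩ := hJ.super _ _ hj
      · rwa [h0, norm_zero]
      · rw [h1, Complex.norm_real, Real.norm_of_nonneg hδ]
    · rwa [hval _ _ hj, norm_zero]

theorem IsJordanDecomp.isTriangularDecomp
    {M : Matrix (Fin n ⊕ Fin m) (Fin n ⊕ Fin m) ℝ} {P J : Matrix (Fin (n + m)) (Fin (n + m)) ℂ}
    (h : IsJordanDecomp M P J δ) (hδ : 0 ≤ δ) : IsTriangularDecomp (complexMat M) P J δ where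
  isUnit_det := h.1
  isUpperTriangular i j hij := by
    have hlt : (j : ℕ) < i := hij
    exact h.2.1.off_eq_zero i j hlt.ne (by omega)
  norm_sub_diagonal_le := h.2.1.norm_sub_diagonal_le hδ
  eq := h.2.2

theorem IsTriangularDecomp.mono {δ' : ℝ} (h : IsTriangularDecomp M P J δ) (hδ : δ ≤ δ') :
    IsTriangularDecomp M P J δ' :=
  { h with norm_sub_diagonal_le := h.norm_sub_diagonal_le.trans hδ }

end Triangular

section Contraction

/-- The conditions on an eigenvalue `w` of the scaled generator `H` under which both `1 + w` (GDA)
and `1 + w + w ^ 2` (EG) are contractions at a rate proportional to `x`. -/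
structure IsStable (w : ℂ) (x : ℝ) : Prop where
  re_le : w.re ≤ -(x / 8)
  norm_sq_le : ‖w‖ ^ 2 ≤ -w.re
  norm_le : ‖w‖ ≤ 3 / 8

namespace IsStable

variable {w : ℂ} {x : ℝ}

theorem norm_one_add_le (h : IsStable w x) (hx : x ≤ 1) : ‖1 + w‖ ≤ 1 - x / 32 := by
  refine abs_le_of_sq_le_sq' ?_ (by linarith) |>.2
  calc ‖1 + w‖ ^ 2 = 1 + 2 * w.re + ‖w‖ ^ 2 := by
        simp only [Complex.sq_norm, Complex.normSq_apply, Complex.add_re, Complex.one_re,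
          Complex.add_im, Complex.one_im]
        ring
    _ ≤ 1 + w.re := by linarith [h.norm_sq_le]
    _ ≤ (1 - x / 32) ^ 2 := by nlinarith [h.re_le, h.norm_sq_le, sq_nonneg ‖w‖]

theorem norm_one_add_add_sq_le (h : IsStable w x) (hx : x ≤ 1) :
    ‖1 + w + w ^ 2‖ ≤ 1 - x / 32 := by
  obtain ⟨hre, hsq, hle⟩ := h
  obtain ⟨t, ht⟩ : ∃ t, w.re = -t := ⟨-w.re, (neg_neg _).symm⟩
  have hexpand : ‖1 + w + w ^ 2‖ ^ 2
      = 1 - 2 * t + 4 * t ^ 2 - ‖w‖ ^ 2 - 2 * t * ‖w‖ ^ 2 + (‖w‖ ^ 2) ^ 2 := by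
    simp only [Complex.sq_norm, Complex.normSq_apply, Complex.add_re, Complex.one_re,
      Complex.add_im, Complex.one_im, pow_two w, Complex.mul_re, Complex.mul_im, ht]
    ring
  have htw : t ≤ ‖w‖ := by linarith [neg_le_of_abs_le (Complex.abs_re_le_norm w)]
  rw [ht] at hre hsq
  rw [neg_neg] at hsq
  have ht0 : 0 ≤ t := by linarith [sq_nonneg ‖w‖]
  have ht2 : t ^ 2 ≤ ‖w‖ ^ 2 := by gcongr
  have hw4 : (‖w‖ ^ 2) ^ 2 ≤ (3 / 8) ^ 2 * t := by
    rw [pow_two]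
    gcongr
  refine abs_le_of_sq_le_sq' ?_ (by linarith) |>.2
  generalize ‖w‖ ^ 2 = N at *
  calc ‖1 + w + w ^ 2‖ ^ 2 ≤ 1 - t / 2 := by
        rw [hexpand]
        have htN : 0 ≤ t * N := by nlinarith
        nlinarith
    _ ≤ 1 - x / 16 := by linarith
    _ ≤ (1 - x / 32) ^ 2 := by nlinarith [sq_nonneg (x / 32)]

end IsStable

theorem norm_one_add_add_sq_add_le {𝔸 : Type*} [NormedRing 𝔸] (D R : 𝔸) :
    ‖1 + (D + R) + (D + R) ^ 2‖ ≤ ‖1 + D + D ^ 2‖ + ‖R‖ * (1 + 2 * ‖D‖ + ‖R‖) :=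
  calc ‖1 + (D + R) + (D + R) ^ 2‖ = ‖(1 + D + D ^ 2) + (R + D * R + R * D + R * R)‖ := by
        congr 1
        noncomm_ring
    _ ≤ ‖1 + D + D ^ 2‖ + (‖R‖ + ‖D‖ * ‖R‖ + ‖R‖ * ‖D‖ + ‖R‖ * ‖R‖) := by
        refine norm_add_le_of_le le_rfl (norm_add_le_of_le ?_ (norm_mul_le _ _))
        exact norm_add_le_of_le (norm_add_le_of_le le_rfl (norm_mul_le _ _)) (norm_mul_le _ _)
    _ = _ := by ring

section DiagonalAdd

variable {N : ℕ} {d : Fin N → ℂ} {R : Matrix (Fin N) (Fin N) ℂ} {x : ℝ}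

theorem norm_diagonal_add_le (hd : ∀ i, IsStable (d i) x) (hx : x ≤ 1) (hR : ‖R‖ ≤ x / 256) :
    ‖Matrix.diagonal d + R‖ ≤ 1 / 2 := by
  linarith [norm_add_le_of_le (norm_diagonal_le (by norm_num) fun i => (hd i).norm_le) hR]

theorem norm_one_add_diagonal_add_le (hd : ∀ i, IsStable (d i) x) (hx : x ≤ 1)
    (hR : ‖R‖ ≤ x / 256) : ‖1 + (Matrix.diagonal d + R)‖ ≤ 1 - x / 64 := by
  have hdiag : 1 + Matrix.diagonal d = Matrix.diagonal fun i => 1 + d i := by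
    rw [← Matrix.diagonal_one, Matrix.diagonal_add]
  have hD : ‖1 + Matrix.diagonal d‖ ≤ 1 - x / 32 := by
    rw [hdiag]
    exact norm_diagonal_le (by linarith) fun i => (hd i).norm_one_add_le hx
  rw [← add_assoc]
  linarith [norm_add_le_of_le hD hR, norm_nonneg R]

theorem norm_one_add_add_sq_diagonal_add_le (hd : ∀ i, IsStable (d i) x) (hx : x ≤ 1)
    (hR : ‖R‖ ≤ x / 256) :
    ‖1 + (Matrix.diagonal d + R) + (Matrix.diagonal d + R) ^ 2‖ ≤ 1 - x / 64 := by
  have hdiag : 1 + Matrix.diagonal d + Matrix.diagonal d ^ 2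
      = Matrix.diagonal fun i => 1 + d i + d i ^ 2 := by
    rw [← Matrix.diagonal_one, Matrix.diagonal_pow, Matrix.diagonal_add, Matrix.diagonal_add]
    rfl
  have hD : ‖1 + Matrix.diagonal d + Matrix.diagonal d ^ 2‖ ≤ 1 - x / 32 := by
    rw [hdiag]
    exact norm_diagonal_le (by linarith) fun i => (hd i).norm_one_add_add_sq_le hx
  have hd' := norm_diagonal_le (by norm_num) fun i => (hd i).norm_le
  have hx0 : 0 ≤ x := by linarith [norm_nonneg R]
  calc _ ≤ _ := norm_one_add_add_sq_add_le _ _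
    _ ≤ (1 - x / 32) + x / 256 * (1 + 2 * (3 / 8) + x / 256) := by gcongr
    _ ≤ 1 - x / 64 := by nlinarith

end DiagonalAdd

section Generator

variable {A : Matrix (Fin m) (Fin m) ℝ} {B : Matrix (Fin n) (Fin m) ℝ}
  {C : Matrix (Fin n) (Fin n) ℝ} {L μ μx r : ℝ} {P J : Matrix (Fin (n + m)) (Fin (n + m)) ℂ}

namespace IsQuadNCSC

theorem one_le_rate_inv (h : IsQuadNCSC A B C L μ μx) (hm : 0 < m) (hr : 2 * (L / μ) ≤ r) :
    1 ≤ r * (L / μx) :=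
  one_le_mul_of_one_le_of_one_le (by linarith [h.two_le_of_two_mul_div_le hm hr])
    ((one_le_div h.mux_pos).mpr h.mux_le_L)

theorem isStable (h : IsQuadNCSC A B C L μ μx) (hm : 0 < m) (hr : 2 * (L / μ) ≤ r) {δ : ℝ}
    (hP : IsTriangularDecomp (complexMat (matM A B C r)) P J δ) (i : Fin (n + m)) :
    IsStable ((1 / (4 * r * L)) • J i i) (1 / (r * (L / μx))) := by
  obtain ⟨w, hw, hMw⟩ := hP.exists_eigenvector i
  obtain ⟨hre, hsq, hle⟩ := h.eigenvalue_bounds hm hr hw hMw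
  have hr2 := h.two_le_of_two_mul_div_le hm hr
  have hL := h.L_pos
  have hμx := h.mux_pos
  have hη : 0 < 1 / (4 * r * L) := by positivity
  refine ⟨?_, ?_, ?_⟩
  · calc ((1 / (4 * r * L)) • J i i).re = 1 / (4 * r * L) * (J i i).re := Complex.smul_re _ _
      _ ≤ 1 / (4 * r * L) * -(μx / 2) := by gcongr
      _ = -(1 / (r * (L / μx)) / 8) := by field_simp; norm_num
  · rw [Complex.smul_re, norm_smul, Real.norm_of_nonneg hη.le, mul_pow]
    calc (1 / (4 * r * L)) ^ 2 * ‖J i i‖ ^ 2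
        ≤ (1 / (4 * r * L)) ^ 2 * (4 * r * L * -(J i i).re) := by gcongr
      _ = -(1 / (4 * r * L) * (J i i).re) := by field_simp
  · rw [norm_smul, Real.norm_of_nonneg hη.le]
    calc 1 / (4 * r * L) * ‖J i i‖ ≤ 1 / (4 * r * L) * ((1 + r) * L) := by gcongr
      _ = (1 + r) / (4 * r) := by field_simp
      _ ≤ 3 / 8 := by
        rw [div_le_div_iff₀ (by positivity) (by norm_num)]
        linarith

theorem norm_generator_le (h : IsQuadNCSC A B C L μ μx) (hm : 0 < m) (hr : 2 * (L / μ) ≤ r)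
    (hP : IsTriangularDecomp (complexMat (matM A B C r)) P J (μx / 64)) :
    ‖(1 / (4 * r * L)) • J‖ ≤ 1 / 2 ∧
    ‖1 + (1 / (4 * r * L)) • J‖ ≤ 1 - 1 / 64 / (r * (L / μx)) ∧
    ‖1 + (1 / (4 * r * L)) • J + ((1 / (4 * r * L)) • J) ^ 2‖ ≤ 1 - 1 / 64 / (r * (L / μx)) := by
  have hr2 := h.two_le_of_two_mul_div_le hm hr
  have hL := h.L_pos
  have hμx := h.mux_pos
  have hd := h.isStable hm hr hP
  have hx : 1 / (r * (L / μx)) ≤ 1 := div_le_one_of_le₀ (h.one_le_rate_inv hm hr) (by positivity)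
  have hsplit : (1 / (4 * r * L)) • J = Matrix.diagonal (fun i => (1 / (4 * r * L)) • J i i)
      + (1 / (4 * r * L)) • (J - Matrix.diagonal J.diag) := by
    rw [smul_sub, ← Matrix.diagonal_smul]
    exact (add_sub_cancel _ _).symm
  have hR : ‖(1 / (4 * r * L)) • (J - Matrix.diagonal J.diag)‖ ≤ 1 / (r * (L / μx)) / 256 := by
    rw [norm_smul, Real.norm_of_nonneg (by positivity)]
    calc _ ≤ 1 / (4 * r * L) * (μx / 64) := by gcongr; exact hP.norm_sub_diagonal_le
      _ = 1 / (r * (L / μx)) / 256 := by field_simp; norm_num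
  rw [hsplit, div_right_comm]
  exact ⟨norm_diagonal_add_le hd hx hR, norm_one_add_diagonal_add_le hd hx hR,
    norm_one_add_add_sq_diagonal_add_le hd hx hR⟩

end IsQuadNCSC

end Generator

end Contraction

section WhiteNoise

variable {Ω : Type u} [MeasurableSpace Ω] {ν : Measure Ω}
  {E F : Type*} [NormedAddCommGroup E] [NormedAddCommGroup F]

theorem integral_norm_sq_add_le {X Y : Ω → E} (hX : MemLp X 2 ν) (hY : MemLp Y 2 ν) :
    ∫ ω, ‖X ω + Y ω‖ ^ 2 ∂ν ≤ 2 * ∫ ω, ‖X ω‖ ^ 2 ∂ν + 2 * ∫ ω, ‖Y ω‖ ^ 2 ∂ν := by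
  have hXsq := (hX.integrable_norm_pow two_ne_zero).const_mul 2
  have hYsq := (hY.integrable_norm_pow two_ne_zero).const_mul 2
  rw [← integral_const_mul, ← integral_const_mul, ← integral_add hXsq hYsq]
  refine integral_mono ((hX.add hY).integrable_norm_pow two_ne_zero) (hXsq.add hYsq) fun ω => ?_
  calc ‖X ω + Y ω‖ ^ 2 ≤ (‖X ω‖ + ‖Y ω‖) ^ 2 := by gcongr; exact norm_add_le _ _
    _ ≤ 2 * ‖X ω‖ ^ 2 + 2 * ‖Y ω‖ ^ 2 := by linarith [add_sq_le (a := ‖X ω‖) (b := ‖Y ω‖)]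

variable [NormedSpace ℝ E] [NormedSpace ℝ F]

theorem integrable_bilin_of_memLp_two {X Y : Ω → E} (hX : MemLp X 2 ν) (hY : MemLp Y 2 ν)
    (β : E →L[ℝ] E →L[ℝ] ℝ) : Integrable (fun ω => β (X ω) (Y ω)) ν := by
  have hdom : Integrable (fun ω => ‖β‖ * (‖X ω‖ * ‖Y ω‖)) ν :=
    (hX.norm.integrable_mul hY.norm).const_mul _
  refine hdom.mono' ?_ (Filter.Eventually.of_forall fun ω => ?_)
  · exact Continuous.comp_aestronglyMeasurable₂ (g := (β · ·)) (by fun_prop) hX.1 hY.1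
  · rw [← mul_assoc]
    exact β.le_opNorm₂ _ _

/-- The cross second moments of `X` and `Y` vanish: every bounded bilinear form in them has mean
zero. For centred `X` and `Y` this says that they are uncorrelated, without reference to an inner
product. -/
def Uncorrelated (ν : Measure Ω) (X Y : Ω → E) : Prop :=
  ∀ β : E →L[ℝ] E →L[ℝ] ℝ, ∫ ω, β (X ω) (Y ω) ∂ν = 0

namespace Uncorrelated

variable {X X' Y Y' : Ω → E}

theorem of_indepFun [CompleteSpace E] [MeasurableSpace E] [BorelSpace E] (h : IndepFun X Y ν)
    (hX : Integrable X ν) (hY : Integrable Y ν) (hX0 : ∫ ω, X ω ∂ν = 0) : Uncorrelated ν X Y := by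
  intro β
  rw [h.integral_bilin hX hY β, hX0, map_zero, zero_apply]

theorem const_left [IsProbabilityMeasure ν] [CompleteSpace E] (x : E) (hY : Integrable Y ν)
    (hY0 : ∫ ω, Y ω ∂ν = 0) : Uncorrelated ν (fun _ => x) Y := by
  intro β
  rw [(β x).integral_comp_comm hY, hY0, map_zero]

theorem map (h : Uncorrelated ν X Y) (K K' : E →L[ℝ] F) :
    Uncorrelated ν (fun ω => K (X ω)) (fun ω => K' (Y ω)) := fun β =>
  h (β.bilinearComp K K')

theorem add_left (h : Uncorrelated ν X Y) (h' : Uncorrelated ν X' Y) (hX : MemLp X 2 ν)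
    (hX' : MemLp X' 2 ν) (hY : MemLp Y 2 ν) : Uncorrelated ν (fun ω => X ω + X' ω) Y := by
  intro β
  simp only [map_add, add_apply]
  rw [integral_add (integrable_bilin_of_memLp_two hX hY β) (integrable_bilin_of_memLp_two hX' hY β),
    h β, h' β, add_zero]

theorem add_right (h : Uncorrelated ν X Y) (h' : Uncorrelated ν X Y') (hX : MemLp X 2 ν)
    (hY : MemLp Y 2 ν) (hY' : MemLp Y' 2 ν) : Uncorrelated ν X (fun ω => Y ω + Y' ω) := by
  intro β
  simp only [map_add]
  rw [integral_add (integrable_bilin_of_memLp_two hX hY β) (integrable_bilin_of_memLp_two hX hY' β),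
    h β, h' β, add_zero]

end Uncorrelated

/-- A sequence of centred, pairwise uncorrelated random vectors with second moments at most `v`:
the form in which the gradient noise enters the convergence proof. -/
structure IsWhiteNoise (ν : Measure Ω) (ξ : ℕ → Ω → E) (v : ℝ) : Prop where
  memLp : ∀ j, MemLp (ξ j) 2 ν
  integral_eq_zero : ∀ j, ∫ ω, ξ j ω ∂ν = 0
  uncorrelated : ∀ i j, i ≠ j → Uncorrelated ν (ξ i) (ξ j)
  integral_norm_sq_le : ∀ j, ∫ ω, ‖ξ j ω‖ ^ 2 ∂ν ≤ v

namespace IsWhiteNoise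

variable {ξ : ℕ → Ω → E} {v : ℝ}

theorem integrable [IsFiniteMeasure ν] (h : IsWhiteNoise ν ξ v) (j : ℕ) : Integrable (ξ j) ν :=
  (h.memLp j).integrable one_le_two

theorem integrable_norm_sq (h : IsWhiteNoise ν ξ v) (j : ℕ) :
    Integrable (fun ω => ‖ξ j ω‖ ^ 2) ν :=
  (h.memLp j).integrable_norm_pow two_ne_zero

theorem integral_norm_sq_map_le (h : IsWhiteNoise ν ξ v) {K : E →L[ℝ] F} {a : ℝ}
    (hK : ∀ x, ‖K x‖ ≤ a * ‖x‖) (j : ℕ) : ∫ ω, ‖K (ξ j ω)‖ ^ 2 ∂ν ≤ a ^ 2 * v :=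
  calc ∫ ω, ‖K (ξ j ω)‖ ^ 2 ∂ν ≤ ∫ ω, a ^ 2 * ‖ξ j ω‖ ^ 2 ∂ν := by
        refine integral_mono ((K.comp_memLp' (h.memLp j)).integrable_norm_pow two_ne_zero)
          ((h.integrable_norm_sq j).const_mul _) fun ω => ?_
        simpa only [mul_pow] using pow_le_pow_left₀ (norm_nonneg _) (hK (ξ j ω)) 2
    _ ≤ a ^ 2 * v := by
        rw [integral_const_mul]
        gcongr
        exact h.integral_norm_sq_le j

theorem nonneg (h : IsWhiteNoise ν ξ v) : 0 ≤ v :=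
  (integral_nonneg fun _ => sq_nonneg _).trans (h.integral_norm_sq_le 0)

theorem mono {w : ℝ} (h : IsWhiteNoise ν ξ v) (hvw : v ≤ w) : IsWhiteNoise ν ξ w :=
  { h with integral_norm_sq_le := fun j => (h.integral_norm_sq_le j).trans hvw }

variable [CompleteSpace E]

theorem map [IsFiniteMeasure ν] [CompleteSpace F] (h : IsWhiteNoise ν ξ v) {K : E →L[ℝ] F} {a : ℝ}
    (hK : ∀ x, ‖K x‖ ≤ a * ‖x‖) : IsWhiteNoise ν (fun j ω => K (ξ j ω)) (a ^ 2 * v) where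
  memLp j := K.comp_memLp' (h.memLp j)
  integral_eq_zero j := by rw [K.integral_comp_comm (h.integrable j), h.integral_eq_zero, map_zero]
  uncorrelated i j hij := (h.uncorrelated i j hij).map K K
  integral_norm_sq_le := h.integral_norm_sq_map_le hK

theorem extrapolated [IsFiniteMeasure ν] (h : IsWhiteNoise ν ξ v) {H : E →L[ℝ] E}
    (hH : ‖H‖ ≤ 1 / 2) :
    IsWhiteNoise ν (fun k ω => H (ξ (2 * k) ω) + ξ (2 * k + 1) ω) (5 / 2 * v) where
  memLp k := (H.comp_memLp' (h.memLp _)).add (h.memLp _)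
  integral_eq_zero k := by
    rw [integral_add (H.integrable_comp (h.integrable _)) (h.integrable _),
      H.integral_comp_comm (h.integrable _), h.integral_eq_zero, h.integral_eq_zero, map_zero,
      add_zero]
  uncorrelated j k hjk := by
    have hid := fun i i' hi => (h.uncorrelated i i' hi).map H (.id ℝ E)
    have hmem := fun i => H.comp_memLp' (h.memLp i)
    have hmem' := h.memLp (2 * j + 1)
    refine Uncorrelated.add_left ?_ ?_ (hmem _) hmem' ((hmem _).add (h.memLp _))
    · exact ((h.uncorrelated _ _ (by omega)).map H H).add_right (hid _ _ (by omega)) (hmem _)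
        (hmem _) (h.memLp _)
    · exact ((h.uncorrelated _ _ (by omega)).map (.id ℝ E) H).add_right
        (h.uncorrelated _ _ (by omega)) hmem' (hmem _) (h.memLp _)
  integral_norm_sq_le k :=
    calc _ ≤ 2 * ∫ ω, ‖H (ξ (2 * k) ω)‖ ^ 2 ∂ν + 2 * ∫ ω, ‖ξ (2 * k + 1) ω‖ ^ 2 ∂ν :=
          integral_norm_sq_add_le (H.comp_memLp' (h.memLp _)) (h.memLp _)
      _ ≤ 2 * ((1 / 2) ^ 2 * v) + 2 * v := by
          gcongr
          · exact h.integral_norm_sq_map_le (H.le_of_opNorm_le hH) _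
          · exact h.integral_norm_sq_le _
      _ = 5 / 2 * v := by ring

end IsWhiteNoise

end WhiteNoise

section LinearRecursion

variable {Ω : Type u} [MeasurableSpace Ω] {ν : Measure Ω} {E : Type*} [NormedAddCommGroup E]
  {Z ξ : ℕ → Ω → E} {v : ℝ}

theorem memLp_and_uncorrelated_of_recursion [IsProbabilityMeasure ν] [NormedSpace ℝ E]
    [CompleteSpace E] {G : E →L[ℝ] E} {z₀ : E} (hZ0 : ∀ ω, Z 0 ω = z₀)
    (hZ : ∀ k ω, Z (k + 1) ω = G (Z k ω) + ξ k ω) (hξ : IsWhiteNoise ν ξ v) (k : ℕ) :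
    MemLp (Z k) 2 ν ∧ ∀ j, k ≤ j → Uncorrelated ν (Z k) (ξ j) := by
  induction k with
  | zero =>
    rw [show Z 0 = fun _ => z₀ from funext hZ0]
    exact ⟨memLp_const _, fun j _ => .const_left z₀ (hξ.integrable j) (hξ.integral_eq_zero j)⟩
  | succ k ih =>
    obtain ⟨hmem, hunc⟩ := ih
    rw [show Z (k + 1) = fun ω => G (Z k ω) + ξ k ω from funext (hZ k)]
    refine ⟨(G.comp_memLp' hmem).add (hξ.memLp k), fun j hj => ?_⟩
    exact ((hunc j (by omega)).map G (.id ℝ E)).add_left (hξ.uncorrelated k j (by omega))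
      (G.comp_memLp' hmem) (hξ.memLp k) (hξ.memLp j)

variable [InnerProductSpace ℝ E]

theorem integral_norm_sq_add_le_of_uncorrelated {G : E →L[ℝ] E} {ρ : ℝ} {X W : Ω → E}
    (hX : MemLp X 2 ν) (hW : MemLp W 2 ν) (hXW : Uncorrelated ν X W) (hG : ‖G‖ ≤ ρ) :
    ∫ ω, ‖G (X ω) + W ω‖ ^ 2 ∂ν ≤ ρ ^ 2 * ∫ ω, ‖X ω‖ ^ 2 ∂ν + ∫ ω, ‖W ω‖ ^ 2 ∂ν := by
  have hGX : Integrable (fun ω => ‖G (X ω)‖ ^ 2) ν :=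
    (G.comp_memLp' hX).integrable_norm_pow two_ne_zero
  have hWsq := hW.integrable_norm_pow two_ne_zero
  have hinner : Integrable (fun ω => 2 * (innerSL ℝ).bilinearComp G (.id ℝ E) (X ω) (W ω)) ν :=
    (integrable_bilin_of_memLp_two hX hW _).const_mul 2
  calc ∫ ω, ‖G (X ω) + W ω‖ ^ 2 ∂ν
      = ∫ ω, (‖G (X ω)‖ ^ 2 + 2 * (innerSL ℝ).bilinearComp G (.id ℝ E) (X ω) (W ω)
          + ‖W ω‖ ^ 2) ∂ν := integral_congr_ae (.of_forall fun ω => norm_add_sq_real _ _)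
    _ = ∫ ω, ‖G (X ω)‖ ^ 2 ∂ν + ∫ ω, ‖W ω‖ ^ 2 ∂ν := by
        have hGXW := hGX.add hinner
        simp only [Pi.add_def] at hGXW
        rw [integral_add hGXW hWsq, integral_add hGX hinner, integral_const_mul, hXW, mul_zero,
          add_zero]
    _ ≤ ∫ ω, ρ ^ 2 * ‖X ω‖ ^ 2 ∂ν + ∫ ω, ‖W ω‖ ^ 2 ∂ν := by
        refine add_le_add_left ?_ _
        refine integral_mono hGX ((hX.integrable_norm_pow two_ne_zero).const_mul _) fun ω => ?_
        simpa only [mul_pow] using pow_le_pow_left₀ (norm_nonneg _) (G.le_of_opNorm_le hG (X ω)) 2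
    _ = _ := by rw [integral_const_mul]

theorem integral_norm_sq_le_of_recursion [IsProbabilityMeasure ν] [CompleteSpace E]
    {G : E →L[ℝ] E} {z₀ : E} {ρ : ℝ} (hZ0 : ∀ ω, Z 0 ω = z₀)
    (hZ : ∀ k ω, Z (k + 1) ω = G (Z k ω) + ξ k ω) (hξ : IsWhiteNoise ν ξ v) (hG : ‖G‖ ≤ ρ)
    (hρ : ρ < 1) (T : ℕ) :
    ∫ ω, ‖Z T ω‖ ^ 2 ∂ν ≤ ρ ^ (2 * T) * ‖z₀‖ ^ 2 + v / (1 - ρ) := by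
  have hv := hξ.nonneg
  have hρ0 : 0 ≤ ρ := (norm_nonneg G).trans hG
  have hρ1 : 0 < 1 - ρ := sub_pos.mpr hρ
  induction T with
  | zero =>
    simp only [hZ0, integral_const, probReal_univ, one_smul, mul_zero, pow_zero, one_mul]
    exact le_add_of_nonneg_right (by positivity)
  | succ k ih =>
    obtain ⟨hmem, hunc⟩ := memLp_and_uncorrelated_of_recursion hZ0 hZ hξ k
    have hsteady : ρ ^ 2 * (v / (1 - ρ)) + v ≤ v / (1 - ρ) := by
      rw [mul_div_assoc', div_add' _ _ _ hρ1.ne', div_le_div_iff_of_pos_right hρ1]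
      nlinarith [mul_nonneg hv (mul_nonneg hρ0 hρ1.le)]
    simp only [hZ]
    calc _ ≤ ρ ^ 2 * ∫ ω, ‖Z k ω‖ ^ 2 ∂ν + ∫ ω, ‖ξ k ω‖ ^ 2 ∂ν :=
          integral_norm_sq_add_le_of_uncorrelated hmem (hξ.memLp k) (hunc k le_rfl) hG
      _ ≤ ρ ^ 2 * (ρ ^ (2 * k) * ‖z₀‖ ^ 2 + v / (1 - ρ)) + v := by
          gcongr
          exact hξ.integral_norm_sq_le k
      _ = ρ ^ (2 * (k + 1)) * ‖z₀‖ ^ 2 + (ρ ^ 2 * (v / (1 - ρ)) + v) := by ring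
      _ ≤ _ := by gcongr

end LinearRecursion

section Gradients

theorem hasGradientAt_const_add_inner_add_inner_self {E : Type*} [NormedAddCommGroup E]
    [InnerProductSpace ℝ E] [CompleteSpace E] {T : E →L[ℝ] E} (hT : (T : E →ₗ[ℝ] E).IsSymmetric)
    (a : ℝ) (b x₀ x : E) :
    HasGradientAt (fun x => a + inner ℝ b (x - x₀) + 1 / 2 * inner ℝ (T (x - x₀)) (x - x₀))
      (b + T (x - x₀)) x := by
  have hsub : HasFDerivAt (fun x => x - x₀) (.id ℝ E) x := (hasFDerivAt_id x).sub_const x₀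
  have hlin : HasFDerivAt (fun x => inner ℝ b (x - x₀)) (innerSL ℝ b) x :=
    ((innerSL ℝ b).hasFDerivAt).comp x hsub
  have hquad : HasFDerivAt (fun x => inner ℝ (T (x - x₀)) (x - x₀))
      (2 • innerSL ℝ (T (x - x₀))) x :=
    (hT.hasStrictFDerivAt_reApplyInnerSelf (x - x₀)).hasFDerivAt.comp (f := (· - x₀)) x hsub
  refine ((hlin.const_add a).add (hquad.const_mul (1 / 2))).congr_fderiv ?_
  ext y
  simp

theorem isSymmetric_toEuclideanCLM {A : Matrix (Fin m) (Fin m) ℝ} (hA : A.IsSymm) :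
    (Matrix.toEuclideanCLM (𝕜 := ℝ) A : Eucl m →ₗ[ℝ] Eucl m).IsSymmetric :=
  Matrix.isSymmetric_toEuclideanLin_iff.mpr
    (A.conjTranspose_eq_transpose_of_trivial.trans hA)

theorem partialGrads_quadFun {A : Matrix (Fin m) (Fin m) ℝ} (B : Matrix (Fin n) (Fin m) ℝ)
    {C : Matrix (Fin n) (Fin n) ℝ} (hA : A.IsSymm) (hC : C.IsSymm) (zs z : Eucl n × Eucl m) :
    partialGrads (quadFun A B C zs) z
      = (WithLp.toLp 2 (B *ᵥ (z.2 - zs.2).ofLp + C *ᵥ (z.1 - zs.1).ofLp),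
        WithLp.toLp 2 (Bᵀ *ᵥ (z.1 - zs.1).ofLp - A *ᵥ (z.2 - zs.2).ofLp)) := by
  refine Prod.ext (HasGradientAt.gradient ?_) (HasGradientAt.gradient ?_)
  · convert hasGradientAt_const_add_inner_add_inner_self (isSymmetric_toEuclideanCLM hC)
      (-(1 / 2) * ((z.2 - zs.2).ofLp ⬝ᵥ (A *ᵥ (z.2 - zs.2).ofLp)))
      (WithLp.toLp 2 (B *ᵥ (z.2 - zs.2).ofLp)) zs.1 z.1 using 2 with x
    · simp only [quadFun, EuclideanSpace.inner_eq_star_dotProduct, Matrix.ofLp_toEuclideanCLM,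
        star_trivial]
    · rfl
  · convert hasGradientAt_const_add_inner_add_inner_self (isSymmetric_toEuclideanCLM hA.neg)
      (1 / 2 * ((z.1 - zs.1).ofLp ⬝ᵥ (C *ᵥ (z.1 - zs.1).ofLp)))
      (WithLp.toLp 2 (Bᵀ *ᵥ (z.1 - zs.1).ofLp)) zs.2 z.2 using 2 with y
    · have hB : (z.1 - zs.1).ofLp ⬝ᵥ (B *ᵥ (y - zs.2).ofLp)
          = (y - zs.2).ofLp ⬝ᵥ (Bᵀ *ᵥ (z.1 - zs.1).ofLp) := by
        rw [Matrix.mulVec_transpose, Matrix.dotProduct_mulVec, dotProduct_comm]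
      simp only [quadFun, EuclideanSpace.inner_eq_star_dotProduct, Matrix.ofLp_toEuclideanCLM,
        star_trivial, Matrix.neg_mulVec, dotProduct_neg, hB]
      ring
    · rw [map_neg, sub_eq_add_neg]
      rfl

end Gradients

section Coordinates

/-- The identification of `ℝⁿ × ℝᵐ` with the real vectors of `ℂⁿ⁺ᵐ`, the coordinates of `x`
first. -/
def stack : WithLp 2 (Eucl n × Eucl m) →ₗᵢ[ℝ] EuclideanSpace ℂ (Fin (n + m)) where
  toFun z := WithLp.toLp 2 fun k =>
    ((Sum.elim z.fst.ofLp z.snd.ofLp (finSumFinEquiv.symm k) : ℝ) : ℂ)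
  map_add' z w := by
    ext k
    obtain ⟨k | k, rfl⟩ := finSumFinEquiv.surjective k <;> simp
  map_smul' c z := by
    ext k
    obtain ⟨k | k, rfl⟩ := finSumFinEquiv.surjective k <;> simp
  norm_map' z := by
    refine (pow_left_inj₀ (norm_nonneg _) (norm_nonneg _) two_ne_zero).mp ?_
    rw [EuclideanSpace.norm_sq_eq, WithLp.prod_norm_sq_eq_of_L2, ← finSumFinEquiv.sum_comp,
      Fintype.sum_sum_type, EuclideanSpace.norm_sq_eq, EuclideanSpace.norm_sq_eq]
    simp

theorem stack_comp_finSumFinEquiv (z : WithLp 2 (Eucl n × Eucl m)) :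
    (stack z).ofLp ∘ finSumFinEquiv = Complex.ofRealHom ∘ Sum.elim z.fst.ofLp z.snd.ofLp := by
  ext k
  simp [stack]

variable {N : ℕ}

/-- A complex matrix as an operator on `ℂᴺ` viewed as a real Euclidean space. -/
def realCLM (H : Matrix (Fin N) (Fin N) ℂ) :
    EuclideanSpace ℂ (Fin N) →L[ℝ] EuclideanSpace ℂ (Fin N) :=
  (Matrix.toEuclideanCLM (𝕜 := ℂ) H).restrictScalars ℝ

theorem norm_realCLM (H : Matrix (Fin N) (Fin N) ℂ) : ‖realCLM H‖ = ‖H‖ := by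
  rw [realCLM, ContinuousLinearMap.norm_restrictScalars, Matrix.l2_opNorm_toEuclideanCLM]

theorem realCLM_add_apply (H K : Matrix (Fin N) (Fin N) ℂ) (v : EuclideanSpace ℂ (Fin N)) :
    realCLM (H + K) v = realCLM H v + realCLM K v := by
  simp [realCLM]

theorem realCLM_mul_apply (H K : Matrix (Fin N) (Fin N) ℂ) (v : EuclideanSpace ℂ (Fin N)) :
    realCLM (H * K) v = realCLM H (realCLM K v) := by
  simp [realCLM]

theorem realCLM_smul_apply (a : ℝ) (H : Matrix (Fin N) (Fin N) ℂ) (v : EuclideanSpace ℂ (Fin N)) :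
    realCLM (a • H) v = a • realCLM H v := by
  exact WithLp.ofLp_injective 2 (Matrix.smul_mulVec a H v.ofLp)

theorem realCLM_one_apply (v : EuclideanSpace ℂ (Fin N)) :
    realCLM (1 : Matrix (Fin N) (Fin N) ℂ) v = v := by
  simp [realCLM]

/-- The coordinates of `z` in the basis that brings `M = P⁻¹ J P` to the form `J`. -/
def coord (P : Matrix (Fin (n + m)) (Fin (n + m)) ℂ) :
    WithLp 2 (Eucl n × Eucl m) →L[ℝ] EuclideanSpace ℂ (Fin (n + m)) :=
  realCLM P ∘L stack.toContinuousLinearMap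

variable {P J : Matrix (Fin (n + m)) (Fin (n + m)) ℂ}

theorem norm_coord_le (P : Matrix (Fin (n + m)) (Fin (n + m)) ℂ)
    (z : WithLp 2 (Eucl n × Eucl m)) : ‖coord P z‖ ≤ ‖P‖ * ‖z‖ := by
  rw [← norm_realCLM, ← stack.norm_map z]
  exact (realCLM P).le_opNorm _

theorem norm_realCLM_inv_coord (hP : IsUnit P.det) (z : WithLp 2 (Eucl n × Eucl m)) :
    ‖realCLM P⁻¹ (coord P z)‖ = ‖z‖ := by
  have hz : realCLM P⁻¹ (realCLM P (stack z)) = stack z := by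
    rw [← realCLM_mul_apply, Matrix.nonsing_inv_mul _ hP, realCLM_one_apply]
  rw [coord, ContinuousLinearMap.comp_apply]
  exact (congrArg norm hz).trans (stack.norm_map z)

theorem stack_eq_realCLM_of_mulVec {M : Matrix (Fin n ⊕ Fin m) (Fin n ⊕ Fin m) ℝ}
    {z w : WithLp 2 (Eucl n × Eucl m)}
    (h : M *ᵥ Sum.elim z.fst.ofLp z.snd.ofLp = Sum.elim w.fst.ofLp w.snd.ofLp) :
    stack w = realCLM (complexMat M) (stack z) := by
  refine (WithLp.ofLp_injective 2 (finSumFinEquiv.surjective.injective_comp_right ?_)).symm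
  refine (complexMat_mulVec_comp M (stack z).ofLp).trans ?_
  change _ = (stack w).ofLp ∘ finSumFinEquiv
  rw [stack_comp_finSumFinEquiv, stack_comp_finSumFinEquiv, ← h]
  ext k
  exact (RingHom.map_mulVec Complex.ofRealHom M _ k).symm

theorem coord_eq_of_mulVec {M : Matrix (Fin n ⊕ Fin m) (Fin n ⊕ Fin m) ℝ} {δ : ℝ}
    (hP : IsTriangularDecomp (complexMat M) P J δ) {z w : WithLp 2 (Eucl n × Eucl m)}
    (h : M *ᵥ Sum.elim z.fst.ofLp z.snd.ofLp = Sum.elim w.fst.ofLp w.snd.ofLp) :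
    coord P w = realCLM J (coord P z) := by
  have hPM : P * complexMat M = J * P := by
    rw [hP.eq, ← mul_assoc, ← mul_assoc, Matrix.mul_nonsing_inv _ hP.isUnit_det, one_mul]
  change realCLM P (stack w) = realCLM J (realCLM P (stack z))
  rw [stack_eq_realCLM_of_mulVec h, ← realCLM_mul_apply, hPM, realCLM_mul_apply]

end Coordinates

section Iteration

/-- The displacement `(-η_x v_x, η_y v_y)` by which a step along `v` changes the iterate. -/
def stepCLM (n m : ℕ) (ηx ηy : ℝ) :
    WithLp 2 (Eucl n × Eucl m) →L[ℝ] WithLp 2 (Eucl n × Eucl m) :=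
  (WithLp.prodContinuousLinearEquiv 2 ℝ (Eucl n) (Eucl m)).symm ∘L
    ((-ηx) • ContinuousLinearMap.id ℝ (Eucl n)).prodMap
      (ηy • ContinuousLinearMap.id ℝ (Eucl m)) ∘L
      WithLp.prodContinuousLinearEquiv 2 ℝ (Eucl n) (Eucl m)

theorem stepCLM_toLp (ηx ηy : ℝ) (v : Eucl n × Eucl m) :
    stepCLM n m ηx ηy (WithLp.toLp 2 v) = WithLp.toLp 2 (-ηx • v.1, ηy • v.2) := rfl

theorem toLp_descentAscent (ηx ηy : ℝ) (w v : Eucl n × Eucl m) :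
    WithLp.toLp 2 (descentAscent ηx ηy w v)
      = WithLp.toLp 2 w + stepCLM n m ηx ηy (WithLp.toLp 2 v) := by
  rw [stepCLM_toLp, ← WithLp.toLp_add, neg_smul]
  refine congrArg _ (Prod.ext (sub_eq_add_neg _ _) rfl)

theorem norm_stepCLM_le {ηx ηy : ℝ} (h0 : 0 ≤ ηx) (hle : ηx ≤ ηy)
    (v : WithLp 2 (Eucl n × Eucl m)) : ‖stepCLM n m ηx ηy v‖ ≤ ηy * ‖v‖ := by
  have hηy : 0 ≤ ηy := h0.trans hle
  have hsq : ‖stepCLM n m ηx ηy v‖ ^ 2 = ηx ^ 2 * ‖v.fst‖ ^ 2 + ηy ^ 2 * ‖v.snd‖ ^ 2 := by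
    rw [← WithLp.toLp_ofLp 2 v, stepCLM_toLp, WithLp.prod_norm_sq_eq_of_L2]
    change ‖-ηx • v.fst‖ ^ 2 + ‖ηy • v.snd‖ ^ 2 = _
    simp only [norm_smul, mul_pow, norm_neg, Real.norm_eq_abs, sq_abs]
  refine le_of_sq_le_sq ?_ (by positivity)
  rw [hsq, mul_pow, WithLp.prod_norm_sq_eq_of_L2, mul_add]
  gcongr

/-- The coordinates of the error `z - z*`. -/
def coordError (P : Matrix (Fin (n + m)) (Fin (n + m)) ℂ) (zs z : Eucl n × Eucl m) :
    EuclideanSpace ℂ (Fin (n + m)) :=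
  coord P (WithLp.toLp 2 (z - zs))

/-- The map that turns the noise in a gradient estimate into the resulting error of a step, in
coordinates. -/
def noiseCLM (P : Matrix (Fin (n + m)) (Fin (n + m)) ℂ) (ηx ηy : ℝ) :
    WithLp 2 (Eucl n × Eucl m) →L[ℝ] EuclideanSpace ℂ (Fin (n + m)) :=
  coord P ∘L stepCLM n m ηx ηy

theorem norm_noiseCLM_le (P : Matrix (Fin (n + m)) (Fin (n + m)) ℂ) {ηx ηy : ℝ} (h0 : 0 ≤ ηx)
    (hle : ηx ≤ ηy) (v : WithLp 2 (Eucl n × Eucl m)) :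
    ‖noiseCLM P ηx ηy v‖ ≤ ‖P‖ * ηy * ‖v‖ := by
  rw [mul_assoc]
  exact (norm_coord_le P _).trans (by gcongr; exact norm_stepCLM_le h0 hle v)

variable {A : Matrix (Fin m) (Fin m) ℝ} {B : Matrix (Fin n) (Fin m) ℝ}
  {C : Matrix (Fin n) (Fin n) ℝ} {P J : Matrix (Fin (n + m)) (Fin (n + m)) ℂ} {ηx ηy r δ : ℝ}
  {Ω : Type u}

theorem noiseCLM_partialGrads (hA : A.IsSymm) (hC : C.IsSymm)
    (hP : IsTriangularDecomp (complexMat (matM A B C r)) P J δ) (hη : ηy = r * ηx)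
    (zs z : Eucl n × Eucl m) :
    noiseCLM P ηx ηy (WithLp.toLp 2 (partialGrads (quadFun A B C zs) z))
      = realCLM (ηx • J) (coordError P zs z) := by
  set x := (z.1 - zs.1).ofLp
  set y := (z.2 - zs.2).ofLp
  have hstep : stepCLM n m ηx ηy (WithLp.toLp 2 (partialGrads (quadFun A B C zs) z))
      = ηx • WithLp.toLp 2
          (WithLp.toLp 2 (-(B *ᵥ y + C *ᵥ x)), WithLp.toLp 2 (r • (Bᵀ *ᵥ x - A *ᵥ y))) := by
    rw [partialGrads_quadFun B hA hC, stepCLM_toLp, hη, ← WithLp.toLp_smul]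
    refine congrArg _ (Prod.ext ?_ ?_)
    · rw [neg_smul, ← smul_neg]
      rfl
    · rw [mul_comm, mul_smul]
      rfl
  have hM : matM A B C r *ᵥ Sum.elim x y
      = Sum.elim (-(B *ᵥ y + C *ᵥ x)) (r • (Bᵀ *ᵥ x - A *ᵥ y)) := by
    rw [matM, Matrix.fromBlocks_mulVec, Sum.elim_comp_inl, Sum.elim_comp_inr]
    simp only [Matrix.neg_mulVec, Matrix.smul_mulVec, neg_add_rev, smul_add, smul_neg,
      sub_eq_add_neg]
  rw [noiseCLM, ContinuousLinearMap.comp_apply, hstep, map_smul, realCLM_smul_apply]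
  exact congrArg _ (coord_eq_of_mulVec hP hM)

theorem coordError_descentAscent (hA : A.IsSymm) (hC : C.IsSymm)
    (hP : IsTriangularDecomp (complexMat (matM A B C r)) P J δ) (hη : ηy = r * ηx)
    (zs z w g : Eucl n × Eucl m) :
    coordError P zs (descentAscent ηx ηy w g) = coordError P zs w
      + (realCLM (ηx • J) (coordError P zs z)
        + noiseCLM P ηx ηy (WithLp.toLp 2 (g - partialGrads (quadFun A B C zs) z))) := by
  rw [← noiseCLM_partialGrads hA hC hP hη, ← map_add, WithLp.toLp_sub 2 g, add_sub_cancel]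
  simp only [coordError, noiseCLM, ContinuousLinearMap.comp_apply, ← map_add, WithLp.toLp_sub,
    toLp_descentAscent, add_sub_right_comm]

theorem coordError_sgda_succ (hA : A.IsSymm) (hC : C.IsSymm)
    (hP : IsTriangularDecomp (complexMat (matM A B C r)) P J δ) (hη : ηy = r * ηx)
    (g : Oracle Ω n m) (zs z₀ : Eucl n × Eucl m) (k : ℕ) (ω : Ω) :
    coordError P zs (sgda g ηx ηy z₀ (k + 1) ω)
      = realCLM (1 + ηx • J) (coordError P zs (sgda g ηx ηy z₀ k ω))
        + noiseCLM P ηx ηy (WithLp.toLp 2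
            (gradNoise (quadFun A B C zs) g (sgda g ηx ηy z₀) k ω)) := by
  rw [sgda, coordError_descentAscent hA hC hP hη zs (sgda g ηx ηy z₀ k ω), realCLM_add_apply,
    realCLM_one_apply, add_assoc, gradNoise]

theorem segQuery_two_mul (g : Oracle Ω n m) (z₀ : Eucl n × Eucl m) (k : ℕ) (ω : Ω) :
    segQuery g ηx ηy z₀ (2 * k) ω = seg g ηx ηy z₀ k ω := by
  simp [segQuery]

theorem segQuery_two_mul_add_one (g : Oracle Ω n m) (z₀ : Eucl n × Eucl m) (k : ℕ) (ω : Ω) :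
    segQuery g ηx ηy z₀ (2 * k + 1) ω = segHalf g ηx ηy z₀ k ω := by
  simp [segQuery, Nat.add_mod, show (2 * k + 1) / 2 = k by omega]

theorem coordError_seg_succ (hA : A.IsSymm) (hC : C.IsSymm)
    (hP : IsTriangularDecomp (complexMat (matM A B C r)) P J δ) (hη : ηy = r * ηx)
    (g : Oracle Ω n m) (zs z₀ : Eucl n × Eucl m) (k : ℕ) (ω : Ω) :
    coordError P zs (seg g ηx ηy z₀ (k + 1) ω)
      = realCLM (1 + ηx • J + (ηx • J) ^ 2) (coordError P zs (seg g ηx ηy z₀ k ω))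
        + (realCLM (ηx • J) (noiseCLM P ηx ηy (WithLp.toLp 2
            (gradNoise (quadFun A B C zs) g (segQuery g ηx ηy z₀) (2 * k) ω)))
          + noiseCLM P ηx ηy (WithLp.toLp 2
            (gradNoise (quadFun A B C zs) g (segQuery g ηx ηy z₀) (2 * k + 1) ω))) := by
  have hhalf := coordError_descentAscent hA hC hP hη zs (seg g ηx ηy z₀ k ω) (seg g ηx ηy z₀ k ω)
    (g (2 * k) ω (seg g ηx ηy z₀ k ω))
  have hfull := coordError_descentAscent hA hC hP hη zs (segHalf g ηx ηy z₀ k ω)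
    (seg g ηx ηy z₀ k ω) (g (2 * k + 1) ω (segHalf g ηx ηy z₀ k ω))
  rw [← segHalf] at hhalf
  rw [seg, ← segHalf, hfull, hhalf]
  simp only [gradNoise, segQuery_two_mul, segQuery_two_mul_add_one, realCLM_add_apply, pow_two,
    realCLM_mul_apply, realCLM_one_apply, map_add]
  abel

end Iteration

section GradientNoise

variable {Ω : Type u} [MeasurableSpace Ω] {ν : Measure Ω} {ξ : ℕ → Ω → Eucl n × Eucl m} {σ : ℝ}
  {S : ℕ}

namespace NoiseAssumption

theorem memLp (h : NoiseAssumption ν ξ σ S) (j : ℕ) : MemLp (ξ j) 2 ν :=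
  memLp_prod_iff.mpr ⟨h.memLp_x j, h.memLp_y j⟩

theorem integrable [IsFiniteMeasure ν] (h : NoiseAssumption ν ξ σ S) (j : ℕ) :
    Integrable (ξ j) ν :=
  (h.memLp j).integrable one_le_two

theorem integral_eq_zero [IsFiniteMeasure ν] (h : NoiseAssumption ν ξ σ S) (j : ℕ) :
    ∫ ω, ξ j ω ∂ν = 0 :=
  Prod.ext ((fst_integral (h.integrable j)).trans (h.mean_x j))
    ((snd_integral (h.integrable j)).trans (h.mean_y j))

theorem isWhiteNoise [IsFiniteMeasure ν] (h : NoiseAssumption ν ξ σ S) :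
    IsWhiteNoise ν (fun j ω => WithLp.toLp 2 (ξ j ω)) (2 * (σ ^ 2 / S)) where
  memLp j := (WithLp.prodContinuousLinearEquiv 2 ℝ (Eucl n) (Eucl m)).symm.toContinuousLinearMap
    |>.comp_memLp' (h.memLp j)
  integral_eq_zero j := by
    refine ((WithLp.prodContinuousLinearEquiv 2 ℝ (Eucl n) (Eucl m)).symm.integral_comp_comm
      (ξ j)).trans ?_
    rw [h.integral_eq_zero, map_zero]
  uncorrelated i j hij :=
    (Uncorrelated.of_indepFun (h.indep.indepFun hij) (h.integrable i) (h.integrable j)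
      (h.integral_eq_zero i)).map
      (WithLp.prodContinuousLinearEquiv 2 ℝ (Eucl n) (Eucl m)).symm.toContinuousLinearMap
      (WithLp.prodContinuousLinearEquiv 2 ℝ (Eucl n) (Eucl m)).symm.toContinuousLinearMap
  integral_norm_sq_le j := by
    simp only [WithLp.prod_norm_sq_eq_of_L2]
    change ∫ ω, (‖(ξ j ω).1‖ ^ 2 + ‖(ξ j ω).2‖ ^ 2) ∂ν ≤ _
    rw [integral_add ((h.memLp_x j).integrable_norm_pow two_ne_zero)
      ((h.memLp_y j).integrable_norm_pow two_ne_zero), two_mul]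
    exact add_le_add (h.second_moment_x j) (h.second_moment_y j)

end NoiseAssumption

end GradientNoise

section Convergence

variable {A : Matrix (Fin m) (Fin m) ℝ} {B : Matrix (Fin n) (Fin m) ℝ}
  {C : Matrix (Fin n) (Fin n) ℝ} {P J : Matrix (Fin (n + m)) (Fin (n + m)) ℂ} {L μ μx r v : ℝ}
  {zs z₀ : Eucl n × Eucl m} {Ω : Type u} [MeasurableSpace Ω] {ν : Measure Ω}

theorem IsQuadNCSC.stepsizes (h : IsQuadNCSC A B C L μ μx) (hm : 0 < m) (hr : 2 * (L / μ) ≤ r) :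
    0 ≤ 1 / (4 * r * L) ∧ 1 / (4 * r * L) ≤ 1 / (4 * L) ∧
      1 / (4 * L) = r * (1 / (4 * r * L)) := by
  have hL := h.L_pos
  have hr2 := h.two_le_of_two_mul_div_le hm hr
  have : 0 < r := by linarith
  refine ⟨by positivity, one_div_le_one_div_of_le (by positivity) ?_, by field_simp⟩
  gcongr
  linarith

theorem norm_realCLM_inv_coordError (hP : IsUnit P.det) (zs z : Eucl n × Eucl m) :
    ‖realCLM P⁻¹ (coordError P zs z)‖ = dist2 z zs :=
  norm_realCLM_inv_coord hP _

theorem memLp_dist2_of_memLp_coordError (hP : IsUnit P.det) {z : Ω → Eucl n × Eucl m}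
    (h : MemLp (fun ω => coordError P zs (z ω)) 2 ν) : MemLp (fun ω => dist2 (z ω) zs) 2 ν := by
  simpa only [Function.comp_def, norm_realCLM_inv_coordError hP] using
    ((realCLM P⁻¹).comp_memLp' h).norm

theorem integral_dist2_sq_le (hP : IsUnit P.det) {z : Ω → Eucl n × Eucl m}
    (h : MemLp (fun ω => coordError P zs (z ω)) 2 ν) :
    ∫ ω, dist2 (z ω) zs ^ 2 ∂ν ≤ ‖P⁻¹‖ ^ 2 * ∫ ω, ‖coordError P zs (z ω)‖ ^ 2 ∂ν := by
  rw [← integral_const_mul]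
  refine integral_mono ((memLp_dist2_of_memLp_coordError hP h).integrable_sq)
    ((h.integrable_norm_pow two_ne_zero).const_mul _) fun ω => ?_
  rw [← norm_realCLM_inv_coordError hP, ← mul_pow]
  gcongr
  exact (realCLM P⁻¹).le_of_opNorm_le (norm_realCLM _).le _

theorem memLp_and_integral_dist2_sq_le_of_recursion [IsProbabilityMeasure ν]
    (h : IsQuadNCSC A B C L μ μx) (hm : 0 < m) (hr : 2 * (L / μ) ≤ r) (hP : IsUnit P.det)
    {z : ℕ → Ω → Eucl n × Eucl m} {G : EuclideanSpace ℂ (Fin (n + m)) →L[ℝ] _}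
    {ζ : ℕ → Ω → EuclideanSpace ℂ (Fin (n + m))} (hz0 : ∀ ω, z 0 ω = z₀)
    (hz : ∀ k ω, coordError P zs (z (k + 1) ω) = G (coordError P zs (z k ω)) + ζ k ω)
    (hζ : IsWhiteNoise ν ζ (5 / 2 * ((‖P‖ * (1 / (4 * L))) ^ 2 * v)))
    (hG : ‖G‖ ≤ 1 - 1 / 64 / (r * (L / μx))) (T : ℕ) :
    MemLp (fun ω => dist2 (z T ω) zs) 2 ν ∧
      ∫ ω, dist2 (z T ω) zs ^ 2 ∂ν
        ≤ condNum P ^ 2 * (1 - 1 / 64 / (r * (L / μx))) ^ (2 * T) * dist2 z₀ zs ^ 2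
          + 10 * (r * (L / μx)) * condNum P ^ 2 * v / L ^ 2 := by
  have hR : 0 < r * (L / μx) := one_pos.trans_le (h.one_le_rate_inv hm hr)
  have hρ : 1 - 1 / 64 / (r * (L / μx)) < 1 := sub_lt_self _ (by positivity)
  have hZ0 : ∀ ω, coordError P zs (z 0 ω) = coordError P zs z₀ := fun ω => by rw [hz0]
  obtain ⟨hmem, -⟩ := memLp_and_uncorrelated_of_recursion (Z := fun k ω => coordError P zs (z k ω))
    hZ0 hz hζ T
  refine ⟨memLp_dist2_of_memLp_coordError hP hmem, ?_⟩
  have hL := h.L_pos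
  calc _ ≤ ‖P⁻¹‖ ^ 2 * ∫ ω, ‖coordError P zs (z T ω)‖ ^ 2 ∂ν := integral_dist2_sq_le hP hmem
    _ ≤ ‖P⁻¹‖ ^ 2 * ((1 - 1 / 64 / (r * (L / μx))) ^ (2 * T) * (‖P‖ * dist2 z₀ zs) ^ 2
          + 5 / 2 * ((‖P‖ * (1 / (4 * L))) ^ 2 * v) / (1 - (1 - 1 / 64 / (r * (L / μx))))) := by
        gcongr
        refine (integral_norm_sq_le_of_recursion (Z := fun k ω => coordError P zs (z k ω)) hZ0 hz hζ
          hG hρ T).trans ?_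
        gcongr
        · exact (even_two_mul T).pow_nonneg _
        · exact norm_coord_le P _
    _ = _ := by
        rw [condNum, sub_sub_cancel]
        field_simp
        ring

theorem memLp_and_integral_dist2_sgda_sq_le [IsProbabilityMeasure ν]
    (h : IsQuadNCSC A B C L μ μx) (hm : 0 < m) (hr : 2 * (L / μ) ≤ r)
    (hP : IsTriangularDecomp (complexMat (matM A B C r)) P J (μx / 64)) {g : Oracle Ω n m}
    (hξ : IsWhiteNoise ν (fun j ω => WithLp.toLp 2 (gradNoise (quadFun A B C zs) g
      (sgda g (1 / (4 * r * L)) (1 / (4 * L)) z₀) j ω)) v) (T : ℕ) :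
    MemLp (fun ω => dist2 (sgda g (1 / (4 * r * L)) (1 / (4 * L)) z₀ T ω) zs) 2 ν ∧
      ∫ ω, dist2 (sgda g (1 / (4 * r * L)) (1 / (4 * L)) z₀ T ω) zs ^ 2 ∂ν
        ≤ condNum P ^ 2 * (1 - 1 / 64 / (r * (L / μx))) ^ (2 * T) * dist2 z₀ zs ^ 2
          + 10 * (r * (L / μx)) * condNum P ^ 2 * v / L ^ 2 := by
  obtain ⟨-, hG, -⟩ := h.norm_generator_le hm hr hP
  obtain ⟨h0, hle, hη⟩ := h.stepsizes hm hr
  have hζ := hξ.map (norm_noiseCLM_le P h0 hle)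
  exact memLp_and_integral_dist2_sq_le_of_recursion h hm hr hP.isUnit_det (fun _ => rfl)
    (coordError_sgda_succ h.symm_A h.symm_C hP hη g zs z₀)
    (hζ.mono (by linarith [hζ.nonneg])) ((norm_realCLM _).trans_le hG) T

theorem memLp_and_integral_dist2_seg_sq_le [IsProbabilityMeasure ν]
    (h : IsQuadNCSC A B C L μ μx) (hm : 0 < m) (hr : 2 * (L / μ) ≤ r)
    (hP : IsTriangularDecomp (complexMat (matM A B C r)) P J (μx / 64)) {g : Oracle Ω n m}
    (hξ : IsWhiteNoise ν (fun j ω => WithLp.toLp 2 (gradNoise (quadFun A B C zs) g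
      (segQuery g (1 / (4 * r * L)) (1 / (4 * L)) z₀) j ω)) v) (T : ℕ) :
    MemLp (fun ω => dist2 (seg g (1 / (4 * r * L)) (1 / (4 * L)) z₀ T ω) zs) 2 ν ∧
      ∫ ω, dist2 (seg g (1 / (4 * r * L)) (1 / (4 * L)) z₀ T ω) zs ^ 2 ∂ν
        ≤ condNum P ^ 2 * (1 - 1 / 64 / (r * (L / μx))) ^ (2 * T) * dist2 z₀ zs ^ 2
          + 10 * (r * (L / μx)) * condNum P ^ 2 * v / L ^ 2 := by
  obtain ⟨hH, -, hG⟩ := h.norm_generator_le hm hr hP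
  obtain ⟨h0, hle, hη⟩ := h.stepsizes hm hr
  have hζ := hξ.map (norm_noiseCLM_le P h0 hle)
  exact memLp_and_integral_dist2_sq_le_of_recursion h hm hr hP.isUnit_det (fun _ => rfl)
    (coordError_seg_succ h.symm_A h.symm_C hP hη g zs z₀)
    (hζ.extrapolated ((norm_realCLM _).trans_le hH)) ((norm_realCLM _).trans_le hG) T

end Convergence

section Complexity

theorem mul_one_sub_pow_le_half {x y : ℝ} (hx : x ≤ 1) {T : ℕ}
    (hT : 2 * max 1 (Real.log y) ≤ T * x) : y * (1 - x) ^ T ≤ 1 / 2 :=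
  calc y * (1 - x) ^ T ≤ Real.exp (Real.log y) * Real.exp (-x) ^ T := by
        have : 0 ≤ 1 - x := sub_nonneg.mpr hx
        gcongr
        · exact Real.le_exp_log y
        · exact Real.one_sub_le_exp_neg x
    _ = Real.exp (Real.log y - T * x) := by
        rw [← Real.exp_nat_mul, ← Real.exp_add, mul_neg, sub_eq_add_neg]
    _ ≤ Real.exp (-1) := by
        gcongr
        linarith [le_max_left 1 (Real.log y), le_max_right 1 (Real.log y)]
    _ ≤ 1 / 2 := Real.exp_neg_one_lt_half.le

theorem ceil_mul_le {a x : ℝ} (ha : 0 ≤ a) (hx : 1 ≤ x) : (⌈a * x⌉₊ : ℝ) ≤ (a + 1) * x := by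
  have hlt := Nat.ceil_lt_add_one (mul_nonneg ha (zero_le_one.trans hx))
  linarith

theorem exists_steps_batchSize {R K d L ε : ℝ} (hR : 1 ≤ R) (hK : 0 ≤ K) (hd : 0 ≤ d)
    (hL : 0 < L) (hε : 0 < ε) (σ : ℝ) :
    ∃ T S : ℕ, 0 < S ∧
      (2 * T : ℝ) * S ≤ 11000 * (R * max 1 (Real.log (K * d / ε))
        * max 1 (R * K ^ 2 * σ ^ 2 / (L ^ 2 * ε ^ 2))) ∧
      K ^ 2 * (1 - 1 / 64 / R) ^ (2 * T) * d ^ 2 + 10 * R * K ^ 2 * (2 * (σ ^ 2 / S)) / L ^ 2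
        ≤ ε ^ 2 := by
  set ℓ := max 1 (Real.log (K * d / ε))
  set b := max 1 (R * K ^ 2 * σ ^ 2 / (L ^ 2 * ε ^ 2))
  have hb : 1 ≤ b := le_max_left _ _
  have hRℓ : 1 ≤ R * ℓ := one_le_mul_of_one_le_of_one_le hR (le_max_left _ _)
  have hS : (0 : ℝ) < ⌈40 * b⌉₊ := by positivity
  refine ⟨⌈128 * (R * ℓ)⌉₊, ⌈40 * b⌉₊, Nat.cast_pos.mp hS, ?_, ?_⟩
  · calc (2 * ⌈128 * (R * ℓ)⌉₊ : ℝ) * ⌈40 * b⌉₊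
        ≤ (2 * ((128 + 1) * (R * ℓ))) * ((40 + 1) * b) := by
          gcongr <;> exact ceil_mul_le (by norm_num) ‹_›
      _ = 10578 * (R * ℓ * b) := by ring
      _ ≤ 11000 * (R * ℓ * b) := by gcongr; norm_num
  set T := ⌈128 * (R * ℓ)⌉₊
  set S := ⌈40 * b⌉₊
  have hx : 1 / 64 / R ≤ 1 := by
    rw [div_div, div_le_one (by positivity)]
    linarith
  have hbias : K * d / ε * (1 - 1 / 64 / R) ^ T ≤ 1 / 2 := by
    refine mul_one_sub_pow_le_half hx ?_
    calc 2 * ℓ = 128 * (R * ℓ) * (1 / 64 / R) := by field_simp; ring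
      _ ≤ T * (1 / 64 / R) := by gcongr; exact Nat.le_ceil _
  have hvar : 20 * (R * K ^ 2 * σ ^ 2 / (L ^ 2 * ε ^ 2)) ≤ S / 2 := by
    linarith [Nat.le_ceil (40 * b), le_max_right 1 (R * K ^ 2 * σ ^ 2 / (L ^ 2 * ε ^ 2))]
  calc K ^ 2 * (1 - 1 / 64 / R) ^ (2 * T) * d ^ 2 + 10 * R * K ^ 2 * (2 * (σ ^ 2 / S)) / L ^ 2
      = (K * d / ε * (1 - 1 / 64 / R) ^ T) ^ 2 * ε ^ 2
        + 20 * (R * K ^ 2 * σ ^ 2 / (L ^ 2 * ε ^ 2)) / S * ε ^ 2 := by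
        rw [mul_comm 2 T, pow_mul]
        field_simp
        ring
    _ ≤ (1 / 2) ^ 2 * ε ^ 2 + S / 2 / S * ε ^ 2 := by
        have := sub_nonneg.mpr hx
        gcongr
    _ ≤ ε ^ 2 := by
        rw [div_right_comm, div_self hS.ne']
        linarith [sq_nonneg ε]

theorem integral_le_of_integral_sq_le {Ω : Type u} [MeasurableSpace Ω] {ν : Measure Ω}
    [IsProbabilityMeasure ν] {X : Ω → ℝ} {ε : ℝ} (hX : MemLp X 2 ν) (hε : 0 ≤ ε)
    (h : ∫ ω, X ω ^ 2 ∂ν ≤ ε ^ 2) : ∫ ω, X ω ∂ν ≤ ε := by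
  refine le_of_sq_le_sq ?_ hε
  have hvar := variance_nonneg X ν
  rw [variance_eq_sub hX, sub_nonneg] at hvar
  exact hvar.trans h

end Complexity

end QuadMinimax

end

open QuadMinimax in
theorem theorem6_general {n m : ℕ} (hm : 0 < m) {A : Matrix (Fin m) (Fin m) ℝ}
    {B : Matrix (Fin n) (Fin m) ℝ} {C : Matrix (Fin n) (Fin n) ℝ} {L μ μx r : ℝ}
    (h : IsQuadNCSC A B C L μ μx) (hr : 2 * (L / μ) ≤ r)
    {P J : Matrix (Fin (n + m)) (Fin (n + m)) ℂ}
    (hP : IsTriangularDecomp (complexMat (matM A B C r)) P J (μx / 64))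
    (zs z₀ : Eucl n × Eucl m) (σ : ℝ) :
    (∀ S : ℕ, 0 < S → ∀ (Ω : Type u) [MeasurableSpace Ω] (ν : Measure Ω)
      [IsProbabilityMeasure ν] (g : Oracle Ω n m),
      (IsWhiteNoise ν (fun j ω => WithLp.toLp 2 (gradNoise (quadFun A B C zs) g
          (sgda g (1 / (4 * r * L)) (1 / (4 * L)) z₀) j ω)) (2 * (σ ^ 2 / S)) →
        ∀ T : ℕ,
          Integrable (fun ω =>
            dist2 (sgda g (1 / (4 * r * L)) (1 / (4 * L)) z₀ T ω) zs ^ 2) ν ∧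
          ∫ ω, dist2 (sgda g (1 / (4 * r * L)) (1 / (4 * L)) z₀ T ω) zs ^ 2 ∂ν
            ≤ condNum P ^ 2 * (1 - 1 / 64 / (r * (L / μx))) ^ (2 * T) * dist2 z₀ zs ^ 2
              + 20 * r * (L / μx) * condNum P ^ 2 * σ ^ 2 / (L ^ 2 * S)) ∧
      (IsWhiteNoise ν (fun j ω => WithLp.toLp 2 (gradNoise (quadFun A B C zs) g
          (segQuery g (1 / (4 * r * L)) (1 / (4 * L)) z₀) j ω)) (2 * (σ ^ 2 / S)) →
        ∀ T : ℕ,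
          Integrable (fun ω =>
            dist2 (seg g (1 / (4 * r * L)) (1 / (4 * L)) z₀ T ω) zs ^ 2) ν ∧
          ∫ ω, dist2 (seg g (1 / (4 * r * L)) (1 / (4 * L)) z₀ T ω) zs ^ 2 ∂ν
            ≤ condNum P ^ 2 * (1 - 1 / 64 / (r * (L / μx))) ^ (2 * T) * dist2 z₀ zs ^ 2
              + 20 * r * (L / μx) * condNum P ^ 2 * σ ^ 2 / (L ^ 2 * S))) ∧
    (∀ ε : ℝ, 0 < ε → ∃ T S : ℕ, 0 < S ∧
      (2 * T : ℝ) * S ≤ 11000 * (r * (L / μx) * max 1 (Real.log (condNum P * dist2 z₀ zs / ε))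
        * max 1 (r * (L / μx) * condNum P ^ 2 * σ ^ 2 / (L ^ 2 * ε ^ 2))) ∧
      ∀ (Ω : Type u) [MeasurableSpace Ω] (ν : Measure Ω) [IsProbabilityMeasure ν]
        (g : Oracle Ω n m),
        (IsWhiteNoise ν (fun j ω => WithLp.toLp 2 (gradNoise (quadFun A B C zs) g
            (sgda g (1 / (4 * r * L)) (1 / (4 * L)) z₀) j ω)) (2 * (σ ^ 2 / S)) →
          Integrable (fun ω => dist2 (sgda g (1 / (4 * r * L)) (1 / (4 * L)) z₀ T ω) zs) ν ∧
          ∫ ω, dist2 (sgda g (1 / (4 * r * L)) (1 / (4 * L)) z₀ T ω) zs ∂ν ≤ ε) ∧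
        (IsWhiteNoise ν (fun j ω => WithLp.toLp 2 (gradNoise (quadFun A B C zs) g
            (segQuery g (1 / (4 * r * L)) (1 / (4 * L)) z₀) j ω)) (2 * (σ ^ 2 / S)) →
          Integrable (fun ω => dist2 (seg g (1 / (4 * r * L)) (1 / (4 * L)) z₀ T ω) zs) ν ∧
          ∫ ω, dist2 (seg g (1 / (4 * r * L)) (1 / (4 * L)) z₀ T ω) zs ∂ν ≤ ε)) := by
  refine ⟨fun S _ Ω _ ν _ g => ⟨fun hξ T => ?_, fun hξ T => ?_⟩, fun ε hε => ?_⟩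
  · obtain ⟨hmem, hle⟩ := memLp_and_integral_dist2_sgda_sq_le h hm hr hP hξ T
    exact ⟨hmem.integrable_sq, hle.trans_eq (by ring)⟩
  · obtain ⟨hmem, hle⟩ := memLp_and_integral_dist2_seg_sq_le h hm hr hP hξ T
    exact ⟨hmem.integrable_sq, hle.trans_eq (by ring)⟩
  obtain ⟨T, S, hS, hcost, hacc⟩ := exists_steps_batchSize (h.one_le_rate_inv hm hr)
    (mul_nonneg (norm_nonneg P) (norm_nonneg P⁻¹)) (norm_nonneg (WithLp.toLp 2 (z₀ - zs)))
    h.L_pos hε σ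
  refine ⟨T, S, hS, hcost, fun Ω _ ν _ g => ⟨fun hξ => ?_, fun hξ => ?_⟩⟩
  · obtain ⟨hmem, hle⟩ := memLp_and_integral_dist2_sgda_sq_le h hm hr hP hξ T
    exact ⟨hmem.integrable one_le_two, integral_le_of_integral_sq_le hmem hε.le (hle.trans hacc)⟩
  · obtain ⟨hmem, hle⟩ := memLp_and_integral_dist2_seg_sq_le h hm hr hP hξ T
    exact ⟨hmem.integrable one_le_two, integral_le_of_integral_sq_le hmem hε.le (hle.trans hacc)⟩

theorem theorem6 :
    -- The convergence bound, with numerical constants `c₁` and `c₂`.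
    (∃ c₁ c₂ : ℝ, 0 < c₁ ∧ c₁ ≤ 1 ∧ 0 < c₂ ∧
      ∀ (n m : ℕ), 0 < n → 0 < m →
      ∀ (A : Matrix (Fin m) (Fin m) ℝ) (B : Matrix (Fin n) (Fin m) ℝ)
        (C : Matrix (Fin n) (Fin n) ℝ) (zs z₀ : QuadMinimax.Eucl n × QuadMinimax.Eucl m)
        (L μ μx r : ℝ),
        QuadMinimax.IsQuadNCSC A B C L μ μx → 2 * (L / μ) ≤ r →
      ∀ (P J : Matrix (Fin (n + m)) (Fin (n + m)) ℂ) (δ : ℝ), 0 < δ → δ ≤ μx / 64 →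
        QuadMinimax.IsJordanDecomp (QuadMinimax.matM A B C r) P J δ →
      ∀ (σ : ℝ) (S : ℕ), 0 ≤ σ → 0 < S →
      ∀ (Ω : Type u) [MeasurableSpace Ω] (ν : Measure Ω) [IsProbabilityMeasure ν]
        (g : QuadMinimax.Oracle Ω n m),
        -- stochastic GDA
        (QuadMinimax.NoiseAssumption ν
            (QuadMinimax.gradNoise (QuadMinimax.quadFun A B C zs) g
              (QuadMinimax.sgda g (1 / (4 * r * L)) (1 / (4 * L)) z₀)) σ S →
          ∀ T : ℕ,
            Integrable (fun ω => QuadMinimax.dist2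
              (QuadMinimax.sgda g (1 / (4 * r * L)) (1 / (4 * L)) z₀ T ω) zs ^ 2) ν ∧
            ∫ ω, QuadMinimax.dist2
                (QuadMinimax.sgda g (1 / (4 * r * L)) (1 / (4 * L)) z₀ T ω) zs ^ 2 ∂ν
              ≤ QuadMinimax.condNum P ^ 2 * (1 - c₁ / (r * (L / μx))) ^ (2 * T)
                  * QuadMinimax.dist2 z₀ zs ^ 2
                + c₂ * r * (L / μx) * QuadMinimax.condNum P ^ 2 * σ ^ 2 / (L ^ 2 * S)) ∧
        -- stochastic EG
        (QuadMinimax.NoiseAssumption ν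
            (QuadMinimax.gradNoise (QuadMinimax.quadFun A B C zs) g
              (QuadMinimax.segQuery g (1 / (4 * r * L)) (1 / (4 * L)) z₀)) σ S →
          ∀ T : ℕ,
            Integrable (fun ω => QuadMinimax.dist2
              (QuadMinimax.seg g (1 / (4 * r * L)) (1 / (4 * L)) z₀ T ω) zs ^ 2) ν ∧
            ∫ ω, QuadMinimax.dist2
                (QuadMinimax.seg g (1 / (4 * r * L)) (1 / (4 * L)) z₀ T ω) zs ^ 2 ∂ν
              ≤ QuadMinimax.condNum P ^ 2 * (1 - c₁ / (r * (L / μx))) ^ (2 * T)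
                  * QuadMinimax.dist2 z₀ zs ^ 2
                + c₂ * r * (L / μx) * QuadMinimax.condNum P ^ 2 * σ ^ 2 / (L ^ 2 * S))) ∧
    -- The gradient complexity, with a numerical constant `c₃`: a number of steps `T` and a batch
    -- size `S` that suffice for every oracle of that batch size, and their total cost
    -- (`S` gradient evaluations per oracle call; one call per GDA step, two calls per EG step).
    (∃ c₃ : ℝ, 0 < c₃ ∧
      ∀ (n m : ℕ), 0 < n → 0 < m →
      ∀ (A : Matrix (Fin m) (Fin m) ℝ) (B : Matrix (Fin n) (Fin m) ℝ)
        (C : Matrix (Fin n) (Fin n) ℝ) (zs z₀ : QuadMinimax.Eucl n × QuadMinimax.Eucl m)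
        (L μ μx r : ℝ),
        QuadMinimax.IsQuadNCSC A B C L μ μx → 2 * (L / μ) ≤ r →
      ∀ (P J : Matrix (Fin (n + m)) (Fin (n + m)) ℂ) (δ : ℝ), 0 < δ → δ ≤ μx / 64 →
        QuadMinimax.IsJordanDecomp (QuadMinimax.matM A B C r) P J δ →
      ∀ (σ ε : ℝ), 0 ≤ σ → 0 < ε →
        -- stochastic GDA
        (∃ T S : ℕ, 0 < S ∧
          (T : ℝ) * S ≤ c₃ * (r * (L / μx)
            * max 1 (Real.log (QuadMinimax.condNum P * QuadMinimax.dist2 z₀ zs / ε))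
            * max 1 (r * (L / μx) * QuadMinimax.condNum P ^ 2 * σ ^ 2 / (L ^ 2 * ε ^ 2))) ∧
          ∀ (Ω : Type u) [MeasurableSpace Ω] (ν : Measure Ω) [IsProbabilityMeasure ν]
            (g : QuadMinimax.Oracle Ω n m),
            QuadMinimax.NoiseAssumption ν
              (QuadMinimax.gradNoise (QuadMinimax.quadFun A B C zs) g
                (QuadMinimax.sgda g (1 / (4 * r * L)) (1 / (4 * L)) z₀)) σ S →
            Integrable (fun ω => QuadMinimax.dist2
              (QuadMinimax.sgda g (1 / (4 * r * L)) (1 / (4 * L)) z₀ T ω) zs) ν ∧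
            ∫ ω, QuadMinimax.dist2
              (QuadMinimax.sgda g (1 / (4 * r * L)) (1 / (4 * L)) z₀ T ω) zs ∂ν ≤ ε) ∧
        -- stochastic EG
        (∃ T S : ℕ, 0 < S ∧
          (2 * T : ℝ) * S ≤ c₃ * (r * (L / μx)
            * max 1 (Real.log (QuadMinimax.condNum P * QuadMinimax.dist2 z₀ zs / ε))
            * max 1 (r * (L / μx) * QuadMinimax.condNum P ^ 2 * σ ^ 2 / (L ^ 2 * ε ^ 2))) ∧
          ∀ (Ω : Type u) [MeasurableSpace Ω] (ν : Measure Ω) [IsProbabilityMeasure ν]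
            (g : QuadMinimax.Oracle Ω n m),
            QuadMinimax.NoiseAssumption ν
              (QuadMinimax.gradNoise (QuadMinimax.quadFun A B C zs) g
                (QuadMinimax.segQuery g (1 / (4 * r * L)) (1 / (4 * L)) z₀)) σ S →
            Integrable (fun ω => QuadMinimax.dist2
              (QuadMinimax.seg g (1 / (4 * r * L)) (1 / (4 * L)) z₀ T ω) zs) ν ∧
            ∫ ω, QuadMinimax.dist2
              (QuadMinimax.seg g (1 / (4 * r * L)) (1 / (4 * L)) z₀ T ω) zs ∂ν ≤ ε)) := by
  refine ⟨⟨1 / 64, 20, by norm_num, by norm_num, by norm_num, ?_⟩, 11000, by norm_num, ?_⟩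
  · intro n m _ hm A B C zs z₀ L μ μx r h hr P J δ hδ hδμ hJ σ S _ hS Ω _ ν _ g
    have hP := (hJ.isTriangularDecomp hδ.le).mono hδμ
    exact ((theorem6_general hm h hr hP zs z₀ σ).1 S hS Ω ν g).imp
      (fun H hξ => H hξ.isWhiteNoise) (fun H hξ => H hξ.isWhiteNoise)
  · intro n m _ hm A B C zs z₀ L μ μx r h hr P J δ hδ hδμ hJ σ ε _ hε
    have hP := (hJ.isTriangularDecomp hδ.le).mono hδμ
    obtain ⟨T, S, hS, hcost, hacc⟩ := (theorem6_general hm h hr hP zs z₀ σ).2 ε hε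
    have hTS : (T : ℝ) * S ≤ 2 * T * S := by
      gcongr
      linarith [T.cast_nonneg (α := ℝ)]
    exact ⟨⟨T, S, hS, hTS.trans hcost, fun Ω _ ν _ g hξ => (hacc Ω ν g).1 hξ.isWhiteNoise⟩,
      T, S, hS, hcost, fun Ω _ ν _ g hξ => (hacc Ω ν g).2 hξ.isWhiteNoise⟩
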